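/- **Setting.** A (finite-horizon) Dec-POMDP is a tuple $D=(\mathcal N,\mathcal S,\mathcal A=\prod_i\mathcal A_i,P,\mathcal R,\mathcal O=\prod_i\mathcal O_i,O,b_0,T)$ with agents $\mathcal N=\{1,\dots,N\}$, finite sets $\mathcal S,\mathcal A_i,\mathcal O_i$ of states, local actions and local observations, kernels $P:\mathcal S\times\mathcal A\to\Delta(\mathcal S)$ and $O:\mathcal S\times\mathcal A\to\Delta(\mathcal O)$, a reward $\mathcal R:\mathcal S\times\mathcal A\to\mathbb R$, an initial distribution $b_0\in\Delta(\mathcal S)$ and a horizon $T\in\mathbb N_0$. A local policy is a map $\pi_i:\bigcup_{0\le t\le T}(\mathcal A_i\times\mathcal O_i)^t\to\Delta(\mathcal A_i)$; $\Pi^D=\prod_i\Pi^D_i$ is the set of joint policies, with its Borel $\sigma$-algebra. Under $\mathbb P_\pi$, $S_0\sim b_0$, and for each $t$, $A_{i,t}\sim\pi_i(\cdot\mid \overline{AO}_{i,t})$ independently over $i$, where $\overline{AO}_{i,t}=(A_{i,0},O_{i,1},\dots,A_{i,t-1},O_{i,t})$, then $S_{t+1}\sim P(\cdot\mid S_t,A_t)$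 and $O_{t+1}\sim O(\cdot\mid S_{t+1},A_t)$. Put $J^D(\pi)=\mathbb E_\pi[\sum_{t=0}^T\mathcal R(S_t,A_t)]$. **Isomorphisms.** For Dec-POMDPs $D,E$ with the same horizon, $\mathrm{Iso}(D,E)$ is the set of tuples $f$ of bijections $f_N:\mathcal N^D\to\mathcal N^E$, $f_S:\mathcal S^D\to\mathcal S^E$, $f_{A_i}:\mathcal A^D_i\to\mathcal A^E_{f_N(i)}$, $f_{O_i}:\mathcal O^D_i\to\mathcal O^E_{f_N(i)}$ that preserve $P,O,\mathcal R,b_0$, where $f$ acts on joint actions by $(fa)_{f_N(i)}=f_{A_i}(a_i)$, and likewise on joint observations; $\mathrm{Aut}(D)=\mathrm{Iso}(D,D)$. The pushforward $f^*\pi\in\Pi^E$ is $(f^*\pi)_i(a_i\mid\tau)=\pi_{f^{-1}i}(f^{-1}a_i\mid f^{-1}\tau)$, and $f^*\nu$ is the image of a distribution $\nu$ on $\Pi^D$ under $f^*$. A labeling $f\in\mathrm{Sym}(D)$ is a tuple of bijections $\mathcal N\to\{1,\dots,N\}$, $\mathcal S\to\{1,\dots,|\mathcal S|\}$, $\mathcal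 A_i\to\{1,\dots,|\mathcal A_i|\}$, $\mathcal O_i\to\{1,\dots,|\mathcal O_i|\}$, and $f^*D$ is the Dec-POMDP obtained by transporting $D$ along $f$. Put $\mathcal D=\{f^*D\mid f\in\mathrm{Sym}(D)\}$, a finite set. **The LFC game.** A learning algorithm $\sigma\in\Sigma^{\mathcal D}$ assigns to each $E\in\mathcal D$ a probability measure $\sigma(E)$ on $\Pi^E$. In the label-free coordination (LFC) game for $D$ the players (principals) are $\mathcal N$, every strategy set is $\Sigma^{\mathcal D}$, and the common payoff is $$U^D(\sigma_1,\dots,\sigma_N)=\mathbb E_{D_i\sim\mathcal U(\mathcal D),\,i\in\mathcal N}\;\mathbb E_{f_j\sim\mathcal U(\mathrm{Iso}(D_j,D)),\,j\in\mathcal N}\;\mathbb E_{\pi^{(k)}\sim f_k^*\sigma_k(D_k),\,k\in\mathcal N}\big[J^D\big((\pi^{(l)}_l)_{l\in\mathcal N}\big)\big],$$ with all draws independent and $\mathcal U$ the uniform distribution. A profile $(\sigma_i)_i$ is a Nash equilibrium if $U^D(\sigma)\ge U^D(\sigma_i',\sigma_{-i})$ for all $i\in\mathcal N$ and $\sigma_i'\in\Sigma^{\mathcal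 D}$. **Other-play (OP).** For a Dec-POMDP $E$ and $\mathbf g\in\mathrm{Aut}(E)^{\mathcal N}$ let $\mathbf g^*\pi=((\mathbf g_i^*\pi)_i)_{i\in\mathcal N}$, $J^E_{\mathrm{OP}}(\pi)=\mathbb E_{\mathbf g\sim\mathcal U(\mathrm{Aut}(E)^{\mathcal N})}[J^E(\mathbf g^*\pi)]$ and $\Pi^E_{\mathrm{OP}}=\arg\max_{\pi\in\Pi^E} J^E_{\mathrm{OP}}(\pi)$. For a distribution $\mu_i$ on $\Pi^E_i$, the corresponding local policy $\pi_i^{\mu_i}$ is given by $\pi_i^{\mu_i}(a_i\mid\tau)=\mathbb P_{\mu_i\otimes\mu_{-i}}(A_{i,t}=a_i\mid\overline{AO}_{i,t}=\tau)$ for any product distribution $\mu_{-i}$ over the other agents' local policies such that $\mathbb P_{\mu_i\otimes\mu_{-i}}(\overline{AO}_{i,t}=\tau)>0$ (here a joint policy is first drawn from $\mu_i\otimes\mu_{-i}$ and then followed; the value does not depend on the choice of $\mu_{-i}$), and $\pi_i^{\mu_i}(a_i\mid\tau)=1/|\mathcal A_i|$ if there is no such $\mu_{-i}$. The symmetrizer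 is $\Psi^E(\pi)=(\pi_i^{\mu_i})_{i\in\mathcal N}$, where $\mu_i$ is the $i$-th marginal of the uniform mixture $\mu$ of the Dirac measures $\delta_{\mathbf g^*\pi}$, $\mathbf g\in\mathrm{Aut}(E)^{\mathcal N}$. Write $\pi\equiv_E\pi'$ if $\Psi^E(\pi)=\Psi^E(\pi')$, $[\pi]$ for the class of $\pi$, and $f^*[\pi]=[f^*\pi]$. **Tie-breaking.** A function $\chi$ assigning a value $\chi(E,\pi)\in[0,1]$ to each $E\in\mathcal D$ and $\pi\in\Pi^E$ is a tie-breaking function for $\mathcal D$ if for every $E\in\mathcal D$ (i) $\chi(E,\cdot)$ attains a maximum on $\Pi^E_{\mathrm{OP}}$, and (ii) $\chi(E,\pi)=\chi(E,\pi')$ implies $\pi\equiv_E\pi'$ for all $\pi,\pi'\in\Pi^E$. It is invariant to isomorphism if $f^*[\pi]=[\pi']$ implies $\chi(E,\pi)=\chi(F,\pi')$ for all $E,F\in\mathcal D$, $f\in\mathrm{Iso}(E,F)$, $\pi\in\Pi^E$, $\pi'\in\Pi^F$. For such a $\chi$, $\sigma^\chi\in\Sigma^{\mathcal D}$ is an OP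 with tie-breaking learning algorithm if for every $E\in\mathcal D$ there is a measurable set $\mathcal Z\subseteq\arg\max_{\pi\in\Pi^E_{\mathrm{OP}}}\chi(E,\pi)$ with $\sigma^\chi(E)(\mathcal Z)=1$. **Corollary.** Let $D$ be a Dec-POMDP, let $\chi$ be a tie-breaking function for $\mathcal D=\{f^*D\mid f\in\mathrm{Sym}(D)\}$ that is invariant to isomorphism, and let $\sigma^\chi$ be an OP with tie-breaking learning algorithm for $\mathcal D$. Then the profile $(\sigma^\chi,\dots,\sigma^\chi)$ in which every principal uses $\sigma^\chi$ is a Nash equilibrium of the LFC game for $D$. -/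

import Mathlib

open MeasureTheory ProbabilityTheory
open scoped BigOperators ENNReal

universe u v

/-- A finite-horizon Dec-POMDP with agents `Fin N` and horizon `T` (time steps `0, …, T`).
Probability mass functions on a finite set `X` are the elements of `stdSimplex ℝ X`. -/
structure DecPOMDP (N T : ℕ) where
  /-- states -/
  S : Type u
  /-- local actions of each agent -/
  A : Fin N → Type u
  /-- local observations of each agent -/
  O : Fin N → Type u
  [fintypeS : Fintype S]
  [fintypeA : ∀ i, Fintype (A i)]
  [fintypeO : ∀ i, Fintype (O i)]
  /-- transition kernel `P(· ∣ s, a)` -/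
  trans : S → (∀ i, A i) → stdSimplex ℝ S
  /-- joint reward function -/
  reward : S → (∀ i, A i) → ℝ
  /-- observation kernel `O(· ∣ s, a)` -/
  obs : S → (∀ i, A i) → stdSimplex ℝ (∀ i, O i)
  /-- initial state distribution `b₀` -/
  init : stdSimplex ℝ S

attribute [instance] DecPOMDP.fintypeS DecPOMDP.fintypeA DecPOMDP.fintypeO

noncomputable section

/-- Transport of a probability mass function along a bijection: `y ↦ p (e⁻¹ y)`. -/
def simplexCongr {X : Type u} {Y : Type v} [Fintype X] [Fintype Y] (e : X ≃ Y)
    (p : stdSimplex ℝ X) : stdSimplex ℝ Y :=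
  ⟨fun y => p (e.symm y), fun y => p.2.1 (e.symm y), by
    rw [← p.2.2]; exact Equiv.sum_comp e.symm (fun x => p x)⟩

namespace DecPOMDP

variable {N T : ℕ}

/-! ### Histories and policies -/

/-- Joint actions. -/
abbrev JointAction (D : DecPOMDP.{u} N T) : Type u := ∀ i, D.A i

/-- Joint observations. -/
abbrev JointObs (D : DecPOMDP.{u} N T) : Type u := ∀ i, D.O i

/-- Local action-observation histories of agent `i`: a length `t ∈ {0, …, T}` together with a
sequence `(a₀, o₁), …, (a_{t-1}, o_t)`. -/
abbrev AOHist (D : DecPOMDP.{u} N T) (i : Fin N) : Type u :=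
  Σ t : Fin (T + 1), Fin (t : ℕ) → D.A i × D.O i

/-- Local stochastic policies of agent `i`, with the Borel σ-algebra of
`[0,1] ^ (A_i × AOHist_i)` (the product of the subspace σ-algebras on the simplices). -/
abbrev LocalPolicy (D : DecPOMDP.{u} N T) (i : Fin N) : Type u :=
  D.AOHist i → stdSimplex ℝ (D.A i)

/-- Joint stochastic policies, with the product σ-algebra. -/
abbrev Policy (D : DecPOMDP.{u} N T) : Type u := ∀ i, D.LocalPolicy i

/-- Complete episodes: the states `s₀, …, s_T`, the joint actions `a₀, …, a_T` and the joint
observations `o₁, …, o_T`, where `obsSeq k` is `o_{k+1}`. -/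
@[ext]
structure Episode (D : DecPOMDP.{u} N T) where
  /-- `S_t` -/
  state : Fin (T + 1) → D.S
  /-- `A_t` -/
  action : Fin (T + 1) → D.JointAction
  /-- `O_{k+1}` -/
  obsSeq : Fin T → D.JointObs

instance (D : DecPOMDP.{u} N T) : Fintype D.Episode :=
  Fintype.ofEquiv
    ((Fin (T + 1) → D.S) × (Fin (T + 1) → D.JointAction) × (Fin T → D.JointObs))
    { toFun := fun x => ⟨x.1, x.2.1, x.2.2⟩
      invFun := fun ω => (ω.state, ω.action, ω.obsSeq)
      left_inv := fun _ => rfl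
      right_inv := fun _ => rfl }

instance (D : DecPOMDP.{u} N T) : MeasurableSpace D.Episode := ⊤

instance (D : DecPOMDP.{u} N T) : DiscreteMeasurableSpace D.Episode := ⟨fun _ => trivial⟩

namespace Episode

variable {D : DecPOMDP.{u} N T}

/-- The action-observation history `(A_{i,0}, O_{i,1}, …, A_{i,t-1}, O_{i,t})` of agent `i`. -/
def ao (ω : D.Episode) (i : Fin N) (t : Fin (T + 1)) : D.AOHist i :=
  ⟨t, fun k => (ω.action ⟨k, k.2.trans t.2⟩ i,
    ω.obsSeq ⟨k, lt_of_lt_of_le k.2 (Nat.lt_succ_iff.mp t.2)⟩ i)⟩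

/-- The return `∑_{t=0}^T R_t`. -/
def ret (ω : D.Episode) : ℝ := ∑ t, D.reward (ω.state t) (ω.action t)

end Episode

/-- The probability of an episode if the agents follow the joint policy `π`: the product of
`b₀(s₀)`, all `π_i(a_{i,t} ∣ τ_{i,t})`, and all
`P(s_{k+1} ∣ s_k, a_k) * O(o_{k+1} ∣ s_{k+1}, a_k)`. -/
def episodeProb (D : DecPOMDP.{u} N T) (π : D.Policy) (ω : D.Episode) : ℝ :=
  D.init (ω.state 0) *
    (∏ t : Fin (T + 1), ∏ i, π i (ω.ao i t) (ω.action t i)) *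
    ∏ k : Fin T,
      D.trans (ω.state k.castSucc) (ω.action k.castSucc) (ω.state k.succ) *
        D.obs (ω.state k.succ) (ω.action k.castSucc) (ω.obsSeq k)

/-- The measure `ℙ_π` on episodes. -/
def episodeMeasure (D : DecPOMDP.{u} N T) (π : D.Policy) : Measure D.Episode :=
  ∑ ω, ENNReal.ofReal (D.episodeProb π ω) • Measure.dirac ω

/-- The self-play objective `J^D(π) = 𝔼_π[∑_t R_t]`. -/
def J (D : DecPOMDP.{u} N T) (π : D.Policy) : ℝ :=
  ∫ ω, ω.ret ∂(D.episodeMeasure π)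

theorem measurable_episodeMeasure (D : DecPOMDP.{u} N T) : Measurable D.episodeMeasure := by
  refine Measure.measurable_of_measurable_coe _ fun s _ => ?_
  simp only [episodeMeasure, Measure.coe_finsetSum, Finset.sum_apply, Measure.smul_apply,
    smul_eq_mul]
  refine Finset.measurable_sum _ fun ω _ => Measurable.mul_const ?_ _
  refine ENNReal.measurable_ofReal.comp ?_
  unfold episodeProb
  refine Measurable.mul_const (Measurable.const_mul ?_ _) _
  refine Finset.measurable_prod _ fun t _ => Finset.measurable_prod _ fun i _ => ?_
  exact (measurable_pi_apply (ω.action t i)).comp (measurable_subtype_coe.comp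
    ((measurable_pi_apply (ω.ao i t)).comp (measurable_pi_apply i)))

/-- The kernel `π ↦ ℙ_π`. -/
def episodeKernel (D : DecPOMDP.{u} N T) : Kernel D.Policy D.Episode :=
  ⟨D.episodeMeasure, D.measurable_episodeMeasure⟩

theorem episodeProb_le_one (D : DecPOMDP.{u} N T) (π : D.Policy) (ω : D.Episode) :
    D.episodeProb π ω ≤ 1 := by
  have h0 : ∀ {X : Type u} [Fintype X] (p : stdSimplex ℝ X) (x : X), 0 ≤ p x :=
    fun p x => p.2.1 x
  have h1 : ∀ {X : Type u} [Fintype X] (p : stdSimplex ℝ X) (x : X), p x ≤ 1 := by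
    intro X _ p x
    rw [← p.2.2]
    exact Finset.single_le_sum (f := fun y => p y) (fun y _ => p.2.1 y) (Finset.mem_univ x)
  unfold episodeProb
  refine mul_le_one₀ (mul_le_one₀ (h1 _ _) ?_ ?_) ?_ ?_
  · exact Finset.prod_nonneg fun t _ => Finset.prod_nonneg fun i _ => h0 _ _
  · exact Finset.prod_le_one (fun t _ => Finset.prod_nonneg fun i _ => h0 _ _)
      fun t _ => Finset.prod_le_one (fun i _ => h0 _ _) fun i _ => h1 _ _
  · exact Finset.prod_nonneg fun k _ => mul_nonneg (h0 _ _) (h0 _ _)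
  · exact Finset.prod_le_one (fun k _ => mul_nonneg (h0 _ _) (h0 _ _))
      fun k _ => mul_le_one₀ (h1 _ _) (h0 _ _) (h1 _ _)

instance (D : DecPOMDP.{u} N T) : IsFiniteKernel D.episodeKernel := by
  refine ⟨⟨Fintype.card D.Episode, ENNReal.natCast_lt_top _, fun π => ?_⟩⟩
  change D.episodeMeasure π Set.univ ≤ _
  simp only [episodeMeasure, Measure.coe_finsetSum, Finset.sum_apply, Measure.smul_apply,
    smul_eq_mul, measure_univ, mul_one]
  calc ∑ ω, ENNReal.ofReal (D.episodeProb π ω) ≤ ∑ _ω : D.Episode, (1 : ℝ≥0∞) :=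
        Finset.sum_le_sum fun ω _ => ENNReal.ofReal_le_one.2 (D.episodeProb_le_one π ω)
    _ = Fintype.card D.Episode := by simp

/-! ### Isomorphisms and the pushforward of policies -/

/-- Isomorphisms from `D` to `E`. The joint maps `f_A`, `f_O` are given by `Equiv.piCongr`:
`(f_A a) (f_N i) = f_{A_i} (a i)`. -/
@[ext]
structure Iso (D : DecPOMDP.{u} N T) (E : DecPOMDP.{v} N T) where
  /-- `f_N` -/
  agent : Fin N ≃ Fin N
  /-- `f_S` -/
  state : D.S ≃ E.S
  /-- `f_{A_i}` -/
  action : ∀ i, D.A i ≃ E.A (agent i)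
  /-- `f_{O_i}` -/
  ob : ∀ i, D.O i ≃ E.O (agent i)
  trans_eq : ∀ s s' a,
    D.trans s a s' = E.trans (state s) (Equiv.piCongr agent action a) (state s')
  obs_eq : ∀ s a o,
    D.obs s a o = E.obs (state s) (Equiv.piCongr agent action a) (Equiv.piCongr agent ob o)
  reward_eq : ∀ s a, D.reward s a = E.reward (state s) (Equiv.piCongr agent action a)
  init_eq : ∀ s, D.init s = E.init (state s)

/-- Automorphisms. -/
abbrev Aut (D : DecPOMDP.{u} N T) : Type u := Iso D D

instance (D : DecPOMDP.{u} N T) (E : DecPOMDP.{v} N T) : Finite (Iso D E) := by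
  refine Finite.of_injective (β := Σ p : Fin N ≃ Fin N,
    (D.S ≃ E.S) × (∀ i, D.A i ≃ E.A (p i)) × (∀ i, D.O i ≃ E.O (p i)))
    (fun f => ⟨f.agent, f.state, f.action, f.ob⟩) ?_
  rintro ⟨p, s, a, o, _, _, _, _⟩ ⟨p', s', a', o', _, _, _, _⟩ h
  simp only [Sigma.mk.injEq] at h
  obtain ⟨rfl, h⟩ := h
  simp only [heq_eq_eq, Prod.mk.injEq] at h
  obtain ⟨rfl, rfl, rfl⟩ := h
  rfl

instance (D : DecPOMDP.{u} N T) (E : DecPOMDP.{v} N T) : Fintype (Iso D E) :=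
  Fintype.ofFinite _

namespace Iso

variable {D : DecPOMDP.{u} N T} {E : DecPOMDP.{v} N T}

/-- Element-wise action of an isomorphism on action-observation histories. -/
def aoMap (f : Iso D E) (i : Fin N) : D.AOHist i ≃ E.AOHist (f.agent i) :=
  Equiv.sigmaCongrRight fun _ =>
    Equiv.piCongrRight fun _ => Equiv.prodCongr (f.action i) (f.ob i)

/-- The local policy of agent `f i` that is obtained from a local policy of agent `i` by
precomposition with `f⁻¹`. -/
def localPush (f : Iso D E) (i : Fin N) : D.LocalPolicy i → E.LocalPolicy (f.agent i) :=
  fun πi τ => simplexCongr (f.action i) (πi ((f.aoMap i).symm τ))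

/-- The pushforward policy `f^*π`: agent `f i` gets the local policy of agent `i`, precomposed
with `f⁻¹`, that is `(f^*π)_{f i}(f a ∣ f τ) = π_i(a ∣ τ)`. -/
def push (f : Iso D E) (π : D.Policy) : E.Policy :=
  Equiv.piCongrLeft E.LocalPolicy f.agent fun i => f.localPush i (π i)

theorem push_apply (f : Iso D E) (π : D.Policy) (i : Fin N) :
    f.push π (f.agent i) = f.localPush i (π i) :=
  Equiv.piCongrLeft_apply_apply E.LocalPolicy f.agent (fun i => f.localPush i (π i)) i

theorem measurable_push (f : Iso D E) : Measurable f.push := by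
  refine measurable_pi_iff.2 fun j => ?_
  obtain ⟨i, rfl⟩ := f.agent.surjective j
  simp only [push_apply]
  refine measurable_pi_iff.2 fun τ => Measurable.subtype_mk (measurable_pi_iff.2 fun a => ?_)
  exact (measurable_pi_apply ((f.action i).symm a)).comp (measurable_subtype_coe.comp
    ((measurable_pi_apply ((f.aoMap i).symm τ)).comp (measurable_pi_apply i)))

/-- The pushforward `f^*ν` of a distribution over policies: the image measure under `f^*`. -/
def pushDist (f : Iso D E) (ν : ProbabilityMeasure D.Policy) : ProbabilityMeasure E.Policy :=
  ν.map f.measurable_push.aemeasurable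

end Iso

/-! ### Labelings and relabeled Dec-POMDPs -/

/-- Labelings `f ∈ Sym(D)`: bijections onto initial segments of the natural numbers. -/
@[ext]
structure Labeling (D : DecPOMDP.{u} N T) where
  /-- `f_N` -/
  agent : Fin N ≃ Fin N
  /-- `f_S` -/
  state : D.S ≃ Fin (Fintype.card D.S)
  /-- `f_{A_i}` -/
  action : ∀ i, D.A i ≃ Fin (Fintype.card (D.A i))
  /-- `f_{O_i}` -/
  ob : ∀ i, D.O i ≃ Fin (Fintype.card (D.O i))

instance (D : DecPOMDP.{u} N T) : Finite (Labeling D) :=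
  Finite.of_injective
    (fun f : Labeling D => (f.agent, f.state, f.action, f.ob)) fun f g h => by
      simp only [Prod.mk.injEq] at h
      exact Labeling.ext h.1 h.2.1 h.2.2.1 h.2.2.2

namespace Labeling

variable {D : DecPOMDP.{u} N T} (f : Labeling D)

/-- The induced bijection `f_A` from joint actions of `D` onto those of `f^*D`. -/
def jointAction :
    D.JointAction ≃ ∀ j, Fin (Fintype.card (D.A (f.agent.symm j))) :=
  Equiv.piCongr f.agent fun i => (f.action i).trans (finCongr (by rw [Equiv.symm_apply_apply]))

/-- The induced bijection `f_O` from joint observations of `D` onto those of `f^*D`. -/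
def jointObs :
    D.JointObs ≃ ∀ j, Fin (Fintype.card (D.O (f.agent.symm j))) :=
  Equiv.piCongr f.agent fun i => (f.ob i).trans (finCongr (by rw [Equiv.symm_apply_apply]))

/-- The relabeled Dec-POMDP `f^*D`. -/
def relabel : DecPOMDP.{0} N T where
  S := Fin (Fintype.card D.S)
  A j := Fin (Fintype.card (D.A (f.agent.symm j)))
  O j := Fin (Fintype.card (D.O (f.agent.symm j)))
  trans s a := simplexCongr f.state (D.trans (f.state.symm s) (f.jointAction.symm a))
  reward s a := D.reward (f.state.symm s) (f.jointAction.symm a)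
  obs s a := simplexCongr f.jointObs (D.obs (f.state.symm s) (f.jointAction.symm a))
  init := simplexCongr f.state D.init

end Labeling

/-- The set `{f^*D ∣ f ∈ Sym(D)}` of relabeled Dec-POMDPs. -/
def relabeled (D : DecPOMDP.{u} N T) : Set (DecPOMDP.{0} N T) :=
  Set.range (Labeling.relabel (D := D))

instance (D : DecPOMDP.{u} N T) : Fintype D.relabeled :=
  (Set.finite_range (Labeling.relabel (D := D))).fintype

/-! ### Learning algorithms and the label-free coordination game -/

/-- Learning algorithms for a set `C` of Dec-POMDPs. -/
abbrev LearningAlgorithm (C : Set (DecPOMDP.{u} N T)) : Type (u + 1) :=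
  ∀ E : C, ProbabilityMeasure E.1.Policy

/-- The common payoff `U^D(σ₁, …, σ_N)` of the label-free coordination game for `D`. The symbol
`𝔼 x, F x` is the uniform average over the finite type of `x`; the uniform distribution on a
product is the product of the uniform distributions. -/
def payoff (D : DecPOMDP.{u} N T) (σ : Fin N → LearningAlgorithm D.relabeled) : ℝ :=
  𝔼 Ds : Fin N → D.relabeled, 𝔼 f : (∀ j, Iso (Ds j).1 D),
    ∫ π : Fin N → D.Policy, D.J (fun l => π l l)
      ∂(Measure.pi fun k => ((f k).pushDist (σ k (Ds k)) : Measure D.Policy))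

/-- Nash equilibria of the label-free coordination game for `D`. -/
def IsNashEquilibrium (D : DecPOMDP.{u} N T) (σ : Fin N → LearningAlgorithm D.relabeled) :
    Prop :=
  ∀ (i : Fin N) (σ' : LearningAlgorithm D.relabeled),
    D.payoff (Function.update σ i σ') ≤ D.payoff σ

/-! ### Other-play -/

/-- For a profile `g` of automorphisms, the policy `g^*π` in which agent `i` follows its local
policy in `(g i)^*π`. -/
def profilePush (D : DecPOMDP.{u} N T) (g : Fin N → D.Aut) (π : D.Policy) : D.Policy :=
  fun i => (g i).push π i

/-- The other-play objective. -/
def JOP (D : DecPOMDP.{u} N T) (π : D.Policy) : ℝ :=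
  𝔼 g : Fin N → D.Aut, D.J (D.profilePush g π)

/-- The set `Π_OP` of OP-optimal policies. -/
def opOptimal (D : DecPOMDP.{u} N T) : Set D.Policy :=
  {π | ∀ π', D.JOP π' ≤ D.JOP π}

/-! ### Policies corresponding to distributions over policies, and the symmetrizer -/

/-- The law of the episode if first a joint policy is sampled, with independent local policies
`π_j ∼ μ_j`, and then the agents follow it (the marginal on episodes of `ℙ_μ`). -/
def mixMeasure (D : DecPOMDP.{u} N T) (μ : ∀ j, ProbabilityMeasure (D.LocalPolicy j)) :
    Measure D.Episode :=
  (Measure.pi fun j => (μ j : Measure (D.LocalPolicy j))).bind D.episodeKernel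

instance (D : DecPOMDP.{u} N T) (μ : ∀ j, ProbabilityMeasure (D.LocalPolicy j)) :
    IsFiniteMeasure (D.mixMeasure μ) := by
  unfold mixMeasure; infer_instance

/-- The event `{AO_{i,t} = τ}`, where `t` is the length of `τ`. -/
def aoEvent (D : DecPOMDP.{u} N T) (i : Fin N) (τ : D.AOHist i) : Set D.Episode :=
  {ω | ω.ao i τ.1 = τ}

/-- The conditional distribution of the action `A_{i,t}` given `AO_{i,t} = τ`. -/
def condAction (D : DecPOMDP.{u} N T) (i : Fin N) (τ : D.AOHist i) (ν : Measure D.Episode)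
    [IsFiniteMeasure ν] (h : ν (D.aoEvent i τ) ≠ 0) : stdSimplex ℝ (D.A i) :=
  ⟨fun a => (ProbabilityTheory.cond ν (D.aoEvent i τ)).real {ω | ω.action τ.1 i = a},
    fun _ => measureReal_nonneg, by
      have := cond_isProbabilityMeasure h
      have hs := sum_measureReal_preimage_singleton (μ := ProbabilityTheory.cond ν (D.aoEvent i τ))
        (f := fun ω : D.Episode => ω.action τ.1 i) Finset.univ
        (fun _ _ => MeasurableSet.of_discrete)
      simpa [Set.preimage, probReal_univ] using hs⟩

theorem nonempty_action (D : DecPOMDP.{u} N T) (i : Fin N)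
    (μ : ProbabilityMeasure (D.LocalPolicy i)) : Nonempty (D.A i) := by
  obtain ⟨π⟩ := μ.nonempty
  by_contra h
  rw [not_nonempty_iff] at h
  have := (π ⟨0, fun k => k.elim0⟩).2.2
  simp at this

open Classical in
/-- The local policy `π_i^{μ_i}` corresponding to a distribution `μ_i` over local policies of agent
`i`. Its value at `τ` is the conditional distribution of `A_{i,t}` given `AO_{i,t} = τ` under
`μ_i ⊗ μ_{-i}`, for any distribution `μ_{-i}` with independent local policies under which that
event has positive probability, and the uniform distribution if there is none. (The `i`-th
component of `μ` is overwritten by `μ_i`, so that `μ` only serves as `μ_{-i}`.) -/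
def correspondingLocal (D : DecPOMDP.{u} N T) (i : Fin N)
    (μi : ProbabilityMeasure (D.LocalPolicy i)) : D.LocalPolicy i := fun τ =>
  if h : ∃ μ : ∀ j, ProbabilityMeasure (D.LocalPolicy j),
      D.mixMeasure (Function.update μ i μi) (D.aoEvent i τ) ≠ 0 then
    D.condAction i τ (D.mixMeasure (Function.update h.choose i μi)) h.choose_spec
  else
    have := D.nonempty_action i μi
    stdSimplex.barycenter

instance (D : DecPOMDP.{u} N T) : Nonempty D.Aut :=
  ⟨{ agent := Equiv.refl _, state := Equiv.refl _, action := fun _ => Equiv.refl _,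
     ob := fun _ => Equiv.refl _, trans_eq := fun _ _ _ => rfl, obs_eq := fun _ _ _ => rfl,
     reward_eq := fun _ _ => rfl, init_eq := fun _ => rfl }⟩

/-- The other-play distribution of `π`: the uniform mixture of the Dirac measures at `g^*π`,
`g ∈ Aut(D)^N`. -/
def opDist (D : DecPOMDP.{u} N T) (π : D.Policy) : ProbabilityMeasure D.Policy :=
  ⟨(Fintype.card (Fin N → D.Aut) : ℝ≥0∞)⁻¹ •
      ∑ g : Fin N → D.Aut, Measure.dirac (D.profilePush g π), ⟨by
    simp only [Measure.smul_apply, Measure.coe_finsetSum, Finset.sum_apply, measure_univ,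
      Finset.sum_const, Finset.card_univ, nsmul_eq_mul, mul_one, smul_eq_mul]
    exact ENNReal.inv_mul_cancel (by simp [Fintype.card_ne_zero]) (ENNReal.natCast_ne_top _)⟩⟩

/-- The symmetrizer `Ψ^D(π) = π^μ`, where `μ` is the other-play distribution of `π`: the local
policy of agent `i` corresponds to the marginal `μ_i`. -/
def symmetrizer (D : DecPOMDP.{u} N T) (π : D.Policy) : D.Policy := fun i =>
  D.correspondingLocal i ((D.opDist π).map (measurable_pi_apply i).aemeasurable)

/-- Equivalence of policies, `π ≡_D π'`. -/
def Equivalent (D : DecPOMDP.{u} N T) (π π' : D.Policy) : Prop :=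
  D.symmetrizer π = D.symmetrizer π'

/-- The equivalence class `[π]`. -/
def eqClass (D : DecPOMDP.{u} N T) (π : D.Policy) : Set D.Policy :=
  {π' | D.Equivalent π' π}

/-! ### Other-play with tie-breaking -/

/-- `χ` is a tie-breaking function for the set `C`. -/
structure IsTieBreaking (C : Set (DecPOMDP.{u} N T))
    (χ : ∀ E : C, E.1.Policy → Set.Icc (0 : ℝ) 1) : Prop where
  attains_max : ∀ E : C, ∃ π ∈ E.1.opOptimal, ∀ π' ∈ E.1.opOptimal, χ E π' ≤ χ E π
  equivalent_of_eq : ∀ (E : C) (π π' : E.1.Policy), χ E π = χ E π' → E.1.Equivalent π π'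

/-- `χ` is invariant to isomorphism; here `f^*[π] = [f^*π]` by definition. -/
def InvariantToIso (C : Set (DecPOMDP.{u} N T))
    (χ : ∀ E : C, E.1.Policy → Set.Icc (0 : ℝ) 1) : Prop :=
  ∀ (E F : C) (f : Iso E.1 F.1) (π : E.1.Policy) (π' : F.1.Policy),
    F.1.eqClass (f.push π) = F.1.eqClass π' → χ E π = χ F π'

/-- `σ` is an OP with tie-breaking learning algorithm for `C` and the function `χ`. -/
def IsOPWithTieBreaking (C : Set (DecPOMDP.{u} N T))
    (χ : ∀ E : C, E.1.Policy → Set.Icc (0 : ℝ) 1) (σ : LearningAlgorithm C) : Prop :=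
  ∀ E : C, ∃ Z : Set E.1.Policy, MeasurableSet Z ∧ Z ⊆ E.1.opOptimal ∧
    (σ E : Measure E.1.Policy) Z = 1 ∧
    Z ⊆ {π | π ∈ E.1.opOptimal ∧ ∀ π' ∈ E.1.opOptimal, χ E π' ≤ χ E π}

end DecPOMDP

end

/-! The probability of an episode is an environment factor times one factor `seqWeight` per agent,
so the expected return is a multilinear function `multiJ` of the agents' contributions. Averaging
over independent draws therefore averages each contribution separately: the other-play value of `π`
is `multiJ` at the orbit averages `orbitAvg D π` (`JOP_eq_multiJ`), and the payoff of the game is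
`multiJ` at the averages `algorithmWeight` (`payoff_eq_multiJ`).

Invariance of `χ` lets isomorphisms carry maximizers to maximizers, and policies with equal `χ`
value have the same symmetrizer. By Kuhn's theorem the symmetrizer determines the orbit averages on
every episode that the environment allows (`seqWeight_correspondingLocal`). Hence if all principals
use `σ`, the contributions are the orbit averages of one OP-optimal policy of `D`.

It remains to see that no agent gains by deviating from the orbit averages of an OP-optimal `π`
(`multiJ_update_le_of_opOptimal`). Shift the local policy of a single agent `k` towards `x`. By
Kuhn's theorem this can be done along a segment of contributions, and all orbit averages move
affinely. Optimality makes the derivative at the start nonpositive. That derivative is a sum over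
agents, because automorphisms spread the change over the orbit of `k`; by symmetry the sum collapses
to the gain of `k` from playing `x` instead of `π k`. A deviation to an arbitrary algorithm only
averages such deviations. -/

noncomputable section

/-! ### Total mass of trajectories -/

/-- The weights of all trajectories of a controlled hidden Markov chain sum up to the total mass of
the vector of initial weights. -/
theorem sum_trajectory_weight {S A O : Type*} [Fintype S] [Fintype A] [Fintype O]
    (p : S → A → S → ℝ) (hp : ∀ s a, ∑ s', p s a s' = 1)
    (q : S → A → O → ℝ) (hq : ∀ s a, ∑ o, q s a o = 1) :
    ∀ (T : ℕ) (b : S → ℝ) (act : ∀ t : Fin (T + 1), (Fin (t : ℕ) → A × O) → A → ℝ)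
      (_ : ∀ t h, ∑ a, act t h a = 1),
      ∑ x : (Fin (T + 1) → S) × (Fin (T + 1) → A) × (Fin T → O),
        b (x.1 0) *
          (∏ t : Fin (T + 1), act t (fun k => (x.2.1 ⟨k, k.2.trans t.2⟩,
            x.2.2 ⟨k, lt_of_lt_of_le k.2 (Nat.lt_succ_iff.mp t.2)⟩)) (x.2.1 t)) *
          ∏ k : Fin T, p (x.1 k.castSucc) (x.2.1 k.castSucc) (x.1 k.succ) *
            q (x.1 k.succ) (x.2.1 k.castSucc) (x.2.2 k) = ∑ s, b s := by
  intro T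
  induction T with
  | zero =>
    intro b act hact
    rw [Fintype.sum_prod_type]
    simp only [Fintype.sum_prod_type, Finset.univ_unique, Finset.sum_singleton,
      Finset.univ_eq_empty, Finset.prod_empty, mul_one]
    rw [← Equiv.sum_comp (Equiv.funUnique (Fin 1) S).symm]
    refine Finset.sum_congr rfl fun s _ => ?_
    rw [← Equiv.sum_comp (Equiv.funUnique (Fin 1) A).symm]
    rw [← Finset.mul_sum]
    conv_rhs => rw [← mul_one (b s), ← hact 0 (fun k => k.elim0)]
    refine congrArg₂ _ rfl (Finset.sum_congr rfl fun a _ => ?_)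
    have : ∀ f g : Fin ((0 : Fin (0+1)) : ℕ) → A × O, f = g := fun f g => funext fun k => k.elim0
    rw [Fin.prod_univ_one]
    exact congrArg (fun h => act 0 h a) (this _ _)
  | succ T ih =>
    intro b act hact
    -- With the first state, action and observation fixed, the rest is again such a sum. The
    -- observation depends on the next state, so its factor joins the new initial weights; these
    -- need not add up to one, which is why the induction runs over arbitrary `b`.
    have key : ∀ s₀ a₀ o₀,
        ∑ x : (Fin (T + 1) → S) × (Fin (T + 1) → A) × (Fin T → O),
          (b s₀ * act 0 (fun k => k.elim0) a₀) * ((p s₀ a₀ (x.1 0) * q (x.1 0) a₀ o₀) *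
          (∏ t : Fin (T + 1), act t.succ (Fin.cons (a₀, o₀) (fun k => (x.2.1 ⟨k, k.2.trans t.2⟩,
            x.2.2 ⟨k, lt_of_lt_of_le k.2 (Nat.lt_succ_iff.mp t.2)⟩)) : Fin ((t : ℕ) + 1) → A × O)
              (x.2.1 t)) *
          ∏ k : Fin T, p (x.1 k.castSucc) (x.2.1 k.castSucc) (x.1 k.succ) *
            q (x.1 k.succ) (x.2.1 k.castSucc) (x.2.2 k)) =
          (b s₀ * act 0 (fun k => k.elim0) a₀) * ∑ s, p s₀ a₀ s * q s a₀ o₀ := by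
      intro s₀ a₀ o₀
      rw [← Finset.mul_sum]
      refine congrArg₂ _ rfl ?_
      exact ih (fun s => p s₀ a₀ s * q s a₀ o₀)
        (fun t h a => act t.succ (Fin.cons (a₀, o₀) h : Fin ((t : ℕ) + 1) → A × O) a)
        (fun t h => hact _ _)
    have hsum : ∑ y : S × A × O, (b y.1 * act 0 (fun k => k.elim0) y.2.1) *
        ∑ s, p y.1 y.2.1 s * q s y.2.1 y.2.2 = ∑ s, b s := by
      simp only [Fintype.sum_prod_type, ← Finset.mul_sum]
      refine Finset.sum_congr rfl fun s _ => ?_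
      have : ∀ a, ∑ o, ∑ s', p s a s' * q s' a o = 1 := by
        intro a
        rw [Finset.sum_comm]
        simp only [← Finset.mul_sum, hq, mul_one, hp]
      simp only [this, mul_one, ← Finset.mul_sum, hact]
    rw [← hsum]
    simp only [← key]
    rw [← Fintype.sum_prod_type']
    let e : ((S × A × O) × ((Fin (T + 1) → S) × (Fin (T + 1) → A) × (Fin T → O))) ≃
        ((Fin (T + 1 + 1) → S) × (Fin (T + 1 + 1) → A) × (Fin (T + 1) → O)) :=
      { toFun := fun z => (Fin.cons z.1.1 z.2.1, Fin.cons z.1.2.1 z.2.2.1,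
          Fin.cons z.1.2.2 z.2.2.2)
        invFun := fun x => ((x.1 0, x.2.1 0, x.2.2 0),
          (Fin.tail x.1, Fin.tail x.2.1, Fin.tail x.2.2))
        left_inv := fun z => by simp
        right_inv := fun x => by simp }
    rw [← Equiv.sum_comp e]
    refine Finset.sum_congr rfl fun z _ => ?_
    obtain ⟨⟨s₀, a₀, o₀⟩, s, a, o⟩ := z
    simp only [e, Equiv.coe_fn_mk, Fin.cons_zero]
    conv_lhs =>
      congr
      · rw [Fin.prod_univ_succ]
      · rw [Fin.prod_univ_succ]
    simp only [Fin.cons_zero, Fin.cons_succ, Fin.castSucc_zero, Fin.castSucc_succ]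
    have h0 : ∀ f g : Fin ((0 : Fin (T + 1 + 1)) : ℕ) → A × O, f = g :=
      fun f g => funext fun k => k.elim0
    have h1 : ∀ t : Fin (T + 1), (fun k : Fin ((t.succ : Fin (T + 1 + 1)) : ℕ) =>
        ((Fin.cons a₀ a : Fin (T + 1 + 1) → A) ⟨k, k.2.trans t.succ.2⟩,
          (Fin.cons o₀ o : Fin (T + 1) → O)
            ⟨k, lt_of_lt_of_le k.2 (Nat.lt_succ_iff.mp t.succ.2)⟩)) =
        (Fin.cons (a₀, o₀) (fun k => (a ⟨k, k.2.trans t.2⟩,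
            o ⟨k, lt_of_lt_of_le k.2 (Nat.lt_succ_iff.mp t.2)⟩)) : Fin ((t : ℕ) + 1) → A × O) := by
      intro t
      funext k
      refine Fin.cases ?_ (fun k => ?_) (show Fin ((t : ℕ) + 1) from k)
      · rfl
      · rfl
    simp only [h1]
    rw [h0 (fun k => _) (fun k => k.elim0)]
    ring

/-! ### Factorization of episode probabilities over agents -/

namespace DecPOMDP

variable {N T : ℕ}

/-- The contribution of the environment to the probability of an episode. -/
def envWeight (D : DecPOMDP.{u} N T) (ω : D.Episode) : ℝ :=
  D.init (ω.state 0) * ∏ k : Fin T,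
      D.trans (ω.state k.castSucc) (ω.action k.castSucc) (ω.state k.succ) *
        D.obs (ω.state k.succ) (ω.action k.castSucc) (ω.obsSeq k)

/-- The contribution of the local policy `x` of agent `i` to the probability of an episode. -/
def seqWeight (D : DecPOMDP.{u} N T) (i : Fin N) (x : D.LocalPolicy i) (ω : D.Episode) : ℝ :=
  ∏ t : Fin (T + 1), x (ω.ao i t) (ω.action t i)

theorem episodeProb_eq (D : DecPOMDP.{u} N T) (π : D.Policy) (ω : D.Episode) :
    D.episodeProb π ω = D.envWeight ω * ∏ i, D.seqWeight i (π i) ω := by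
  unfold episodeProb envWeight seqWeight
  rw [Finset.prod_comm]
  ring

theorem envWeight_nonneg (D : DecPOMDP.{u} N T) (ω : D.Episode) : 0 ≤ D.envWeight ω :=
  mul_nonneg (stdSimplex.zero_le _ _) (Finset.prod_nonneg fun _ _ =>
    mul_nonneg (stdSimplex.zero_le _ _) (stdSimplex.zero_le _ _))

theorem seqWeight_nonneg (D : DecPOMDP.{u} N T) (i : Fin N) (x : D.LocalPolicy i)
    (ω : D.Episode) : 0 ≤ D.seqWeight i x ω :=
  Finset.prod_nonneg fun _ _ => stdSimplex.zero_le _ _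

theorem seqWeight_le_one (D : DecPOMDP.{u} N T) (i : Fin N) (x : D.LocalPolicy i)
    (ω : D.Episode) : D.seqWeight i x ω ≤ 1 :=
  Finset.prod_le_one (fun _ _ => stdSimplex.zero_le _ _) fun _ _ => stdSimplex.le_one _ _

theorem episodeProb_nonneg (D : DecPOMDP.{u} N T) (π : D.Policy) (ω : D.Episode) :
    0 ≤ D.episodeProb π ω := by
  rw [episodeProb_eq]
  exact mul_nonneg (D.envWeight_nonneg ω) (Finset.prod_nonneg fun _ _ => D.seqWeight_nonneg _ _ _)

/-- Episodes as triples of sequences. -/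
def episodeEquiv (D : DecPOMDP.{u} N T) :
    ((Fin (T + 1) → D.S) × (Fin (T + 1) → D.JointAction) × (Fin T → D.JointObs)) ≃ D.Episode where
  toFun x := ⟨x.1, x.2.1, x.2.2⟩
  invFun ω := (ω.state, ω.action, ω.obsSeq)
  left_inv _ := rfl
  right_inv _ := rfl

theorem sum_episodeProb (D : DecPOMDP.{u} N T) (π : D.Policy) : ∑ ω, D.episodeProb π ω = 1 := by
  classical
  rw [← Equiv.sum_comp D.episodeEquiv, ← stdSimplex.sum_eq_one D.init]
  exact sum_trajectory_weight (fun s a s' => D.trans s a s') (fun s a => stdSimplex.sum_eq_one _)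
    (fun s a o => D.obs s a o) (fun s a => stdSimplex.sum_eq_one _) T (fun s => D.init s)
    (fun t h a => ∏ i, π i ⟨t, fun k => ((h k).1 i, (h k).2 i)⟩ (a i)) (fun t h => by
      rw [← Fintype.prod_sum (fun i (b : D.A i) => π i ⟨t, fun k => ((h k).1 i, (h k).2 i)⟩ b)]
      simp only [stdSimplex.sum_eq_one, Finset.prod_const_one])

/-! ### Realization of distributions over local policies by local policies -/

theorem measurable_localPolicy_apply (D : DecPOMDP.{u} N T) (i : Fin N) (τ : D.AOHist i)
    (a : D.A i) : Measurable fun x : D.LocalPolicy i => x τ a :=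
  (measurable_pi_apply a).comp (measurable_subtype_coe.comp (measurable_pi_apply τ))

theorem measurable_seqWeight (D : DecPOMDP.{u} N T) (i : Fin N) (ω : D.Episode) :
    Measurable fun x : D.LocalPolicy i => D.seqWeight i x ω :=
  Finset.measurable_prod _ fun _ _ => D.measurable_localPolicy_apply i _ _

theorem integrable_of_mem_Icc {X : Type*} [MeasurableSpace X] {μ : Measure X} [IsFiniteMeasure μ]
    {f : X → ℝ} (hf : Measurable f) (h0 : ∀ x, 0 ≤ f x) (h1 : ∀ x, f x ≤ 1) : Integrable f μ :=
  Integrable.of_bound hf.aestronglyMeasurable 1 (ae_of_all _ fun x => by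
    rw [Real.norm_of_nonneg (h0 x)]; exact h1 x)

theorem integrable_seqWeight (D : DecPOMDP.{u} N T) (i : Fin N) (ω : D.Episode)
    (μ : Measure (D.LocalPolicy i)) [IsFiniteMeasure μ] :
    Integrable (fun x => D.seqWeight i x ω) μ :=
  integrable_of_mem_Icc (D.measurable_seqWeight i ω) (fun x => D.seqWeight_nonneg i x ω)
    (fun x => D.seqWeight_le_one i x ω)

/-- The probability that the local policy `x` plays the actions of the history `τ`, given the
observations of `τ`. -/
def histWeight (D : DecPOMDP.{u} N T) (i : Fin N) (x : D.LocalPolicy i) (τ : D.AOHist i) : ℝ :=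
  ∏ k : Fin (τ.1 : ℕ), x ⟨⟨k, k.2.trans τ.1.2⟩, fun j => τ.2 ⟨j, j.2.trans k.2⟩⟩ (τ.2 k).1

theorem measurable_histWeight (D : DecPOMDP.{u} N T) (i : Fin N) (τ : D.AOHist i) :
    Measurable fun x : D.LocalPolicy i => D.histWeight i x τ :=
  Finset.measurable_prod _ fun _ _ => D.measurable_localPolicy_apply i _ _

theorem histWeight_nonneg (D : DecPOMDP.{u} N T) (i : Fin N) (x : D.LocalPolicy i)
    (τ : D.AOHist i) : 0 ≤ D.histWeight i x τ :=
  Finset.prod_nonneg fun _ _ => stdSimplex.zero_le _ _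

theorem histWeight_le_one (D : DecPOMDP.{u} N T) (i : Fin N) (x : D.LocalPolicy i)
    (τ : D.AOHist i) : D.histWeight i x τ ≤ 1 :=
  Finset.prod_le_one (fun _ _ => stdSimplex.zero_le _ _) fun _ _ => stdSimplex.le_one _ _

theorem integrable_histWeight (D : DecPOMDP.{u} N T) (i : Fin N) (τ : D.AOHist i)
    (μ : Measure (D.LocalPolicy i)) [IsFiniteMeasure μ] :
    Integrable (fun x => D.histWeight i x τ) μ :=
  integrable_of_mem_Icc (D.measurable_histWeight i τ) (fun x => D.histWeight_nonneg i x τ)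
    (fun x => D.histWeight_le_one i x τ)

theorem integrable_histWeight_mul (D : DecPOMDP.{u} N T) (i : Fin N) (τ : D.AOHist i) (a : D.A i)
    (μ : Measure (D.LocalPolicy i)) [IsFiniteMeasure μ] :
    Integrable (fun x => D.histWeight i x τ * x τ a) μ :=
  integrable_of_mem_Icc ((D.measurable_histWeight i τ).mul (D.measurable_localPolicy_apply i τ a))
    (fun x => mul_nonneg (D.histWeight_nonneg i x τ) (stdSimplex.zero_le _ _))
    (fun x => mul_le_one₀ (D.histWeight_le_one i x τ) (stdSimplex.zero_le _ _) (stdSimplex.le_one _ _))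

/-- Kuhn's theorem: every distribution over local policies is realized by a local policy. -/
theorem exists_seqWeight_eq_integral (D : DecPOMDP.{u} N T) (i : Fin N)
    (μ : Measure (D.LocalPolicy i)) [IsProbabilityMeasure μ] :
    ∃ y : D.LocalPolicy i, ∀ ω, D.seqWeight i y ω = ∫ x, D.seqWeight i x ω ∂μ := by
  classical
  obtain ⟨x₀⟩ : Nonempty (D.LocalPolicy i) := nonempty_of_isProbabilityMeasure μ
  have hle : ∀ τ a, ∫ x, D.histWeight i x τ * x τ a ∂μ ≤ ∫ x, D.histWeight i x τ ∂μ :=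
    fun τ a => integral_mono (D.integrable_histWeight_mul i τ a μ) (D.integrable_histWeight i τ μ)
      fun x => mul_le_of_le_one_right (D.histWeight_nonneg i x τ) (stdSimplex.le_one _ _)
  have hnn : ∀ τ a, 0 ≤ ∫ x, D.histWeight i x τ * x τ a ∂μ :=
    fun τ a => integral_nonneg fun x => mul_nonneg (D.histWeight_nonneg i x τ) (stdSimplex.zero_le _ _)
  have hex : ∀ τ, ∃ p : stdSimplex ℝ (D.A i), ∀ a,
      (∫ x, D.histWeight i x τ ∂μ) * p a = ∫ x, D.histWeight i x τ * x τ a ∂μ := by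
    intro τ
    by_cases h : ∫ x, D.histWeight i x τ ∂μ = 0
    -- A history of weight zero leaves the action distribution free. A sampled policy `x₀` supplies
    -- one, since `D.A i` is not assumed nonempty.
    · refine ⟨x₀ τ, fun a => ?_⟩
      rw [h, zero_mul]
      exact le_antisymm (hnn τ a) (h ▸ hle τ a)
    · refine ⟨⟨fun a => (∫ x, D.histWeight i x τ * x τ a ∂μ) / ∫ x, D.histWeight i x τ ∂μ,
        fun a => div_nonneg (hnn τ a) (integral_nonneg fun x => D.histWeight_nonneg i x τ), ?_⟩,
        fun a => mul_div_cancel₀ _ h⟩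
      rw [← Finset.sum_div, ← integral_finsetSum _ fun a _ => D.integrable_histWeight_mul i τ a μ]
      simp only [← Finset.mul_sum, stdSimplex.sum_eq_one, mul_one]
      exact div_self h
  choose y hy using hex
  refine ⟨y, fun ω => ?_⟩
  -- The conditional action probabilities telescope along the episode: the product of the first `m`
  -- factors under the integral is the `histWeight` of the history at time `m`.
  have key : ∀ (m : ℕ) (hm : m ≤ T + 1),
      ∏ t : Fin m, y (ω.ao i (t.castLE hm)) (ω.action (t.castLE hm) i) =
        ∫ x, ∏ t : Fin m, x (ω.ao i (t.castLE hm)) (ω.action (t.castLE hm) i) ∂μ := by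
    intro m
    induction m with
    | zero => intro hm; simp
    | succ m ih =>
      intro hm
      simp only [Fin.prod_univ_castSucc]
      have := ih (by omega)
      refine Eq.trans (congrArg₂ _ this rfl) ?_
      exact hy (ω.ao i ⟨m, hm⟩) (ω.action ⟨m, hm⟩ i)
  exact key (T + 1) le_rfl

/-! ### Episode probabilities -/

theorem episodeMeasure_apply (D : DecPOMDP.{u} N T) (π : D.Policy) (s : Set D.Episode) :
    D.episodeMeasure π s = ENNReal.ofReal (∑ ω, s.indicator (D.episodeProb π) ω) := by
  rw [ENNReal.ofReal_sum_of_nonneg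
    (fun ω _ => Set.indicator_nonneg (fun ω _ => D.episodeProb_nonneg π ω) ω)]
  simp only [episodeMeasure, Measure.coe_finsetSum, Finset.sum_apply, Measure.smul_apply,
    smul_eq_mul]
  refine Finset.sum_congr rfl fun ω _ => ?_
  rw [Measure.dirac_apply' _ (MeasurableSet.of_discrete)]
  by_cases h : ω ∈ s <;> simp [h]

theorem integral_episodeMeasure (D : DecPOMDP.{u} N T) (π : D.Policy) (F : D.Episode → ℝ) :
    ∫ ω, F ω ∂(D.episodeMeasure π) = ∑ ω, D.episodeProb π ω * F ω := by
  unfold episodeMeasure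
  rw [integral_finsetSum_measure (fun ω _ =>
    Integrable.smul_measure (integrable_dirac (by simp)) (by simp))]
  refine Finset.sum_congr rfl fun ω _ => ?_
  rw [integral_smul_measure, integral_dirac, ENNReal.toReal_ofReal (D.episodeProb_nonneg π ω),
    smul_eq_mul]

theorem integral_pi_prod_seqWeight (D : DecPOMDP.{u} N T)
    (μ : ∀ j, ProbabilityMeasure (D.LocalPolicy j)) (ω : D.Episode) :
    ∫ π, D.episodeProb π ω ∂(Measure.pi fun j => (μ j : Measure (D.LocalPolicy j))) =
      D.envWeight ω * ∏ j, ∫ x, D.seqWeight j x ω ∂(μ j : Measure (D.LocalPolicy j)) := by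
  simp only [episodeProb_eq]
  rw [integral_const_mul, integral_fintype_prod_eq_prod (fun j x => D.seqWeight j x ω)]

theorem measurable_episodeProb (D : DecPOMDP.{u} N T) (ω : D.Episode) :
    Measurable fun π => D.episodeProb π ω := by
  simp only [episodeProb_eq]
  exact (Finset.measurable_prod _ fun i _ =>
    (D.measurable_seqWeight i ω).comp (measurable_pi_apply i)).const_mul _

/-- Local policies are drawn independently and each enters an episode probability through one
factor, so integration acts factor by factor. This replaces a mixture by a single joint policy. -/
theorem mixMeasure_eq (D : DecPOMDP.{u} N T) (μ : ∀ j, ProbabilityMeasure (D.LocalPolicy j))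
    (π : D.Policy)
    (h : ∀ j ω, D.seqWeight j (π j) ω = ∫ x, D.seqWeight j x ω ∂(μ j : Measure (D.LocalPolicy j))) :
    D.mixMeasure μ = D.episodeMeasure π := by
  classical
  refine Measure.ext_of_singleton fun ω => ?_
  unfold mixMeasure
  rw [Measure.bind_apply (MeasurableSet.of_discrete) D.episodeKernel.measurable.aemeasurable]
  change ∫⁻ π', D.episodeMeasure π' {ω} ∂_ = _
  have hs : ∀ π', ∑ ω', ({ω} : Set D.Episode).indicator (D.episodeProb π') ω' =
      D.episodeProb π' ω := fun π' => by
    rw [Finset.sum_eq_single ω] <;> simp +contextual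
  simp only [episodeMeasure_apply, hs]
  rw [← ofReal_integral_eq_lintegral_ofReal (integrable_of_mem_Icc (D.measurable_episodeProb ω)
    (fun π => D.episodeProb_nonneg π ω) (fun π => D.episodeProb_le_one π ω))
    (ae_of_all _ fun π => D.episodeProb_nonneg π ω), integral_pi_prod_seqWeight, episodeProb_eq]
  simp only [h]

/-- A history carries its length, so `τ` is met at most once in an episode and one factor changes.
The cross-multiplied form avoids dividing by a probability that may vanish. -/
theorem seqWeight_update (D : DecPOMDP.{u} N T) [∀ j, DecidableEq (D.AOHist j)] (i : Fin N)
    (x : D.LocalPolicy i)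
    (τ : D.AOHist i) (p : stdSimplex ℝ (D.A i)) (ω : D.Episode) (h : ω ∈ D.aoEvent i τ) :
    x τ (ω.action τ.1 i) * D.seqWeight i (Function.update x τ p) ω =
      p (ω.action τ.1 i) * D.seqWeight i x ω := by
  have h' : ω.ao i τ.1 = τ := h
  have hne : ∀ t ∈ Finset.univ.erase τ.1, ω.ao i t ≠ τ := fun t ht hc =>
    Finset.ne_of_mem_erase ht (congrArg Sigma.fst hc)
  unfold seqWeight
  rw [← Finset.mul_prod_erase _ _ (Finset.mem_univ τ.1),
    ← Finset.mul_prod_erase (a := τ.1) _ (fun t => x (ω.ao i t) (ω.action t i)) (Finset.mem_univ τ.1),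
    h', Function.update_self, Finset.prod_congr rfl fun t ht => by
      rw [Function.update_of_ne (hne t ht)]]
  ring

theorem seqWeight_update_of_notMem (D : DecPOMDP.{u} N T) [∀ j, DecidableEq (D.AOHist j)]
    (i : Fin N) (x : D.LocalPolicy i)
    (τ : D.AOHist i) (p : stdSimplex ℝ (D.A i)) (ω : D.Episode) (h : ω ∉ D.aoEvent i τ) :
    D.seqWeight i (Function.update x τ p) ω = D.seqWeight i x ω := by
  refine Finset.prod_congr rfl fun t _ => ?_
  rw [Function.update_of_ne]
  rintro rfl
  exact h rfl

/-- Let agent `i` play `a` for sure at `τ`. Episodes that avoid `τ` keep their probability and the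
total mass stays one, so reaching `τ` keeps its probability too. On that event, the original weight
of episodes with action `a` is `π i τ a` times the new one. -/
theorem sum_indicator_aoEvent_action (D : DecPOMDP.{u} N T) (π : D.Policy) (i : Fin N)
    (τ : D.AOHist i) (a : D.A i) :
    ∑ ω, (D.aoEvent i τ ∩ {ω | ω.action τ.1 i = a}).indicator (D.episodeProb π) ω =
      π i τ a * ∑ ω, (D.aoEvent i τ).indicator (D.episodeProb π) ω := by
  classical
  set x : D.LocalPolicy i := Function.update (π i) τ (stdSimplex.vertex a) with hx
  set π' : D.Policy := Function.update π i x with hπ'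
  have hfac : ∀ (y : D.LocalPolicy i) ω, D.episodeProb (Function.update π i y) ω =
      D.envWeight ω * (D.seqWeight i y ω * ∏ j ∈ Finset.univ.erase i, D.seqWeight j (π j) ω) := by
    intro y ω
    rw [episodeProb_eq, ← Finset.mul_prod_erase _ _ (Finset.mem_univ i), Function.update_self]
    refine congrArg₂ _ rfl (congrArg₂ _ rfl (Finset.prod_congr rfl fun j hj => ?_))
    rw [Function.update_of_ne (Finset.ne_of_mem_erase hj)]
  have hself := hfac (π i)
  rw [Function.update_eq_self] at hself
  have hin : ∀ ω, (D.aoEvent i τ ∩ {ω | ω.action τ.1 i = a}).indicator (D.episodeProb π) ω =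
      π i τ a * (D.aoEvent i τ).indicator (D.episodeProb π') ω := by
    intro ω
    by_cases h1 : ω ∈ D.aoEvent i τ
    · have hs := D.seqWeight_update i (π i) τ (stdSimplex.vertex a) ω h1
      rw [← hx] at hs
      by_cases h2 : ω.action τ.1 i = a
      · have hv : (stdSimplex.vertex a : stdSimplex ℝ (D.A i)) a = 1 := by simp [stdSimplex.vertex_coe]
        rw [Set.indicator_of_mem (Set.mem_inter h1 h2), Set.indicator_of_mem h1, hself, hfac]
        rw [h2, hv, one_mul] at hs
        rw [← hs]; ring
      · have hv : (stdSimplex.vertex a : stdSimplex ℝ (D.A i)) (ω.action τ.1 i) = 0 := by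
          simp [stdSimplex.vertex_coe, h2]
        rw [Set.indicator_of_notMem (fun h => h2 h.2), Set.indicator_of_mem h1, hfac]
        have : D.seqWeight i x ω = 0 := by
          refine Finset.prod_eq_zero (Finset.mem_univ τ.1) ?_
          rw [show ω.ao i τ.1 = τ from h1, hx, Function.update_self, hv]
        rw [this]; ring
    · rw [Set.indicator_of_notMem (fun h => h1 h.1), Set.indicator_of_notMem h1, mul_zero]
  have hout : ∀ ω, (D.aoEvent i τ)ᶜ.indicator (D.episodeProb π') ω =
      (D.aoEvent i τ)ᶜ.indicator (D.episodeProb π) ω := by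
    intro ω
    by_cases h1 : ω ∈ D.aoEvent i τ
    · simp [h1]
    · rw [Set.indicator_of_mem h1, Set.indicator_of_mem h1, hself, hfac, hx,
        D.seqWeight_update_of_notMem i (π i) τ _ ω h1]
  have htot : ∀ ρ : D.Policy, ∑ ω, (D.aoEvent i τ).indicator (D.episodeProb ρ) ω +
      ∑ ω, (D.aoEvent i τ)ᶜ.indicator (D.episodeProb ρ) ω = 1 := by
    intro ρ
    rw [← Finset.sum_add_distrib, ← D.sum_episodeProb ρ]
    exact Finset.sum_congr rfl fun ω _ => Set.indicator_self_add_compl_apply _ _ _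
  have h1 := htot π
  have h2 := htot π'
  simp only [hout] at h2
  simp only [hin, ← Finset.mul_sum]
  rw [show ∑ ω, (D.aoEvent i τ).indicator (D.episodeProb π') ω =
    ∑ ω, (D.aoEvent i τ).indicator (D.episodeProb π) ω by linarith]

theorem condAction_episodeMeasure (D : DecPOMDP.{u} N T) (π : D.Policy) (i : Fin N)
    (τ : D.AOHist i) (ν : Measure D.Episode) [IsFiniteMeasure ν] (h : ν (D.aoEvent i τ) ≠ 0)
    (hν : ν = D.episodeMeasure π) : D.condAction i τ ν h = π i τ := by
  refine Subtype.ext (funext fun a => ?_)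
  change (ProbabilityTheory.cond ν (D.aoEvent i τ)).real {ω | ω.action τ.1 i = a} = π i τ a
  have hs : ∀ s : Set D.Episode, ν.real s = ∑ ω, s.indicator (D.episodeProb π) ω := by
    intro s
    rw [Measure.real, hν, episodeMeasure_apply, ENNReal.toReal_ofReal
      (Finset.sum_nonneg fun ω _ => Set.indicator_nonneg (fun ω _ => D.episodeProb_nonneg π ω) ω)]
  have h0 : ν.real (D.aoEvent i τ) ≠ 0 := by
    rwa [Ne, measureReal_eq_zero_iff]
  rw [Measure.real, ProbabilityTheory.cond_apply MeasurableSet.of_discrete, ENNReal.toReal_mul,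
    ENNReal.toReal_inv, ← Measure.real, ← Measure.real, hs (_ ∩ _),
    sum_indicator_aoEvent_action, ← hs]
  field_simp

/-- The local policy corresponding to a distribution over local policies realizes it on all episodes
that are possible in the environment. -/
theorem seqWeight_correspondingLocal (D : DecPOMDP.{u} N T) (i : Fin N)
    (μi : ProbabilityMeasure (D.LocalPolicy i)) (ω : D.Episode) (hω : D.envWeight ω ≠ 0) :
    D.seqWeight i (D.correspondingLocal i μi) ω =
      ∫ x, D.seqWeight i x ω ∂(μi : Measure (D.LocalPolicy i)) := by
  classical
  obtain ⟨y, hy⟩ := D.exists_seqWeight_eq_integral i (μi : Measure (D.LocalPolicy i))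
  rw [← hy]
  have hreach : ∀ τ, (∃ μ : ∀ j, ProbabilityMeasure (D.LocalPolicy j),
      D.mixMeasure (Function.update μ i μi) (D.aoEvent i τ) ≠ 0) →
      D.correspondingLocal i μi τ = y τ := by
    intro τ h
    unfold correspondingLocal
    rw [dif_pos h]
    -- By Kuhn's theorem the chosen opponents may also be replaced by local policies, so the
    -- conditional action probability is read off from `y` and does not depend on that choice.
    choose z hz using fun j => D.exists_seqWeight_eq_integral j
      (h.choose j : Measure (D.LocalPolicy j))
    have := D.condAction_episodeMeasure (Function.update z i y) i τ
      (D.mixMeasure (Function.update h.choose i μi)) h.choose_spec (D.mixMeasure_eq _ _ ?_)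
    · rw [this, Function.update_self]
    · intro j ω
      by_cases hj : j = i
      · subst hj
        simp only [Function.update_self]
        exact hy ω
      · simp only [Function.update_of_ne hj]
        exact hz j ω
  have : ∀ j, Nonempty (D.A j) := fun j => ⟨ω.action 0 j⟩
  -- Uniform opponents give every episode a positive factor, so each history on an episode with
  -- nonzero environment and `y` weights is reachable.
  let b : D.Policy := fun _ _ => stdSimplex.barycenter
  have hb : ∀ j ω', 0 < D.seqWeight j (b j) ω' := fun j ω' => Finset.prod_pos fun t _ => by
    change 0 < ((Fintype.card (D.A j) : ℝ)⁻¹)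
    exact inv_pos.2 (Nat.cast_pos.2 Fintype.card_pos)
  let μb : ∀ j, ProbabilityMeasure (D.LocalPolicy j) := fun j =>
    ⟨Measure.dirac (b j), inferInstance⟩
  have hmix : D.mixMeasure (Function.update μb i μi) =
      D.episodeMeasure (Function.update b i y) := by
    refine D.mixMeasure_eq _ _ fun j ω => ?_
    by_cases hj : j = i
    · subst hj
      simp only [Function.update_self]
      exact hy ω
    · simp only [Function.update_of_ne hj]
      exact (integral_dirac' _ _ (D.measurable_seqWeight j ω).stronglyMeasurable).symm
  have hfac : ∀ (x : D.LocalPolicy i) ω', D.episodeProb (Function.update b i x) ω' =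
      D.envWeight ω' * (∏ j ∈ Finset.univ.erase i, D.seqWeight j (b j) ω') *
        D.seqWeight i x ω' := by
    intro x ω'
    rw [episodeProb_eq, ← Finset.mul_prod_erase _ _ (Finset.mem_univ i), Function.update_self,
      mul_assoc, mul_comm (D.seqWeight i x ω')]
    refine congrArg₂ _ rfl (congrArg₂ _ (Finset.prod_congr rfl fun j hj => ?_) rfl)
    rw [Function.update_of_ne (Finset.ne_of_mem_erase hj)]
  have hothers : ∀ ω', 0 < ∏ j ∈ Finset.univ.erase i, D.seqWeight j (b j) ω' :=
    fun ω' => Finset.prod_pos fun j _ => hb j ω'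
  have hpos : ∀ ω', D.envWeight ω' ≠ 0 → D.seqWeight i y ω' ≠ 0 →
      D.seqWeight i (D.correspondingLocal i μi) ω' = D.seqWeight i y ω' := by
    intro ω' h1 h2
    refine Finset.prod_congr rfl fun t _ => ?_
    rw [hreach]
    refine ⟨μb, ?_⟩
    rw [hmix, episodeMeasure_apply, Ne, ENNReal.ofReal_eq_zero, not_le]
    have hnn : ∀ ω'' ∈ Finset.univ, 0 ≤ (D.aoEvent i (ω'.ao i t)).indicator
        (D.episodeProb (Function.update b i y)) ω'' := fun ω'' _ =>
      Set.indicator_nonneg (fun ω _ => D.episodeProb_nonneg _ ω) ω''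
    refine lt_of_lt_of_le ?_ (Finset.single_le_sum hnn (Finset.mem_univ ω'))
    rw [Set.indicator_of_mem (show ω' ∈ D.aoEvent i (ω'.ao i t) from rfl), hfac]
    exact mul_pos (mul_pos ((D.envWeight_nonneg ω').lt_of_ne' h1) (hothers ω'))
      ((D.seqWeight_nonneg i y ω').lt_of_ne' h2)
  by_cases hyω : D.seqWeight i y ω = 0
  -- Here the histories of the episode need not be reachable, and a counting argument takes over:
  -- both policies have total mass one, and the corresponding policy never has the smaller
  -- probability, so the two agree on every episode.
  · have hsum : ∑ ω', (D.episodeProb (Function.update b i (D.correspondingLocal i μi)) ω' -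
        D.episodeProb (Function.update b i y) ω') = 0 := by
      rw [Finset.sum_sub_distrib, sum_episodeProb, sum_episodeProb, sub_self]
    have hnn : ∀ ω' ∈ Finset.univ,
        0 ≤ D.episodeProb (Function.update b i (D.correspondingLocal i μi)) ω' -
        D.episodeProb (Function.update b i y) ω' := by
      intro ω' _
      rw [hfac, hfac, ← mul_sub]
      by_cases h1 : D.envWeight ω' = 0
      · simp [h1]
      by_cases h2 : D.seqWeight i y ω' = 0
      · rw [h2, sub_zero]
        exact mul_nonneg (mul_nonneg (D.envWeight_nonneg ω') (hothers ω').le)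
          (D.seqWeight_nonneg _ _ _)
      · rw [hpos ω' h1 h2, sub_self, mul_zero]
    have := (Finset.sum_eq_zero_iff_of_nonneg hnn).1 hsum ω (Finset.mem_univ ω)
    rw [hfac, hfac, ← mul_sub] at this
    exact sub_eq_zero.1 ((mul_eq_zero.1 this).resolve_left (mul_ne_zero hω (hothers ω).ne'))
  · exact hpos ω hω hyω

end DecPOMDP

end

-- Isomorphisms and their action on policies and episodes

universe w

theorem simplexCongr_apply_apply {X : Type u} {Y : Type v} [Fintype X] [Fintype Y] (e : X ≃ Y)
    (p : stdSimplex ℝ X) (x : X) : simplexCongr e p (e x) = p x :=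
  congrArg p (e.symm_apply_apply x)

theorem Equiv.piCongr_trans_apply {ι : Type*} {A : ι → Type u} {B : ι → Type v} {C : ι → Type w}
    (e : ι ≃ ι) (e' : ι ≃ ι) (p : ∀ i, A i ≃ B (e i)) (q : ∀ i, B i ≃ C (e' i)) (a : ∀ i, A i) :
    Equiv.piCongr (W := A) (Z := C) (e.trans e') (fun i => (p i).trans (q (e i))) a =
      Equiv.piCongr e' q (Equiv.piCongr e p a) := by
  funext j
  obtain ⟨i, rfl⟩ := (e.trans e').surjective j
  rw [Equiv.piCongr_apply_apply]
  change _ = Equiv.piCongr e' q (Equiv.piCongr e p a) (e' (e i))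
  rw [Equiv.piCongr_apply_apply, Equiv.piCongr_apply_apply]
  rfl

/-- The inverse maps start from `B (e (e.symm j))` instead of `B j`, which forces the cast; on
families it only renames an index. This is what `Iso.symm` needs. -/
theorem Equiv.piCongr_cast_symm_apply {ι : Type*} {A : ι → Type u} {B : ι → Type v}
    (e : ι ≃ ι) (p : ∀ i, A i ≃ B (e i)) (b : ∀ i, B i) :
    Equiv.piCongr (W := B) (Z := A) e.symm (fun j =>
      (Equiv.cast (congrArg B (e.apply_symm_apply j).symm)).trans (p (e.symm j)).symm) b =
      (Equiv.piCongr e p).symm b := by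
  obtain ⟨a, rfl⟩ := (Equiv.piCongr e p).surjective b
  rw [Equiv.symm_apply_apply]
  funext i
  obtain ⟨j, rfl⟩ := e.symm.surjective i
  rw [Equiv.piCongr_apply_apply]
  have hc : ∀ (b : ∀ i, B i) (j k : ι) (h : j = k), cast (congrArg B h) (b j) = b k := by
    rintro b j _ rfl
    rfl
  rw [Equiv.trans_apply, Equiv.cast_apply, hc _ j (e (e.symm j)) (e.apply_symm_apply j).symm,
    Equiv.piCongr_apply_apply, Equiv.symm_apply_apply]

noncomputable section

namespace DecPOMDP

variable {N T : ℕ}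

namespace Iso

variable {D : DecPOMDP.{u} N T} {E : DecPOMDP.{v} N T} {F : DecPOMDP.{w} N T}

/-- The identity. -/
protected def refl (D : DecPOMDP.{u} N T) : Iso D D where
  agent := Equiv.refl _
  state := Equiv.refl _
  action _ := Equiv.refl _
  ob _ := Equiv.refl _
  trans_eq _ _ _ := rfl
  obs_eq _ _ _ := rfl
  reward_eq _ _ := rfl
  init_eq _ := rfl

/-- Composition of isomorphisms. -/
protected def trans (f : Iso D E) (g : Iso E F) : Iso D F where
  agent := f.agent.trans g.agent
  state := f.state.trans g.state
  action i := (f.action i).trans (g.action (f.agent i))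
  ob i := (f.ob i).trans (g.ob (f.agent i))
  trans_eq s s' a := by
    rw [f.trans_eq, g.trans_eq, Equiv.piCongr_trans_apply]; rfl
  obs_eq s a o := by
    rw [f.obs_eq, g.obs_eq, Equiv.piCongr_trans_apply, Equiv.piCongr_trans_apply]; rfl
  reward_eq s a := by
    rw [f.reward_eq, g.reward_eq, Equiv.piCongr_trans_apply]; rfl
  init_eq s := by
    rw [f.init_eq, g.init_eq]; rfl

/-- The inverse isomorphism. -/
protected def symm (f : Iso D E) : Iso E D where
  agent := f.agent.symm
  state := f.state.symm
  action j := (Equiv.cast (congrArg E.A (f.agent.apply_symm_apply j).symm)).trans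
    (f.action (f.agent.symm j)).symm
  ob j := (Equiv.cast (congrArg E.O (f.agent.apply_symm_apply j).symm)).trans
    (f.ob (f.agent.symm j)).symm
  trans_eq s s' a := by
    rw [Equiv.piCongr_cast_symm_apply, f.trans_eq]
    simp only [Equiv.apply_symm_apply]
  obs_eq s a o := by
    rw [Equiv.piCongr_cast_symm_apply, Equiv.piCongr_cast_symm_apply, f.obs_eq]
    simp only [Equiv.apply_symm_apply]
  reward_eq s a := by
    rw [Equiv.piCongr_cast_symm_apply, f.reward_eq]
    simp only [Equiv.apply_symm_apply]
  init_eq s := by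
    rw [f.init_eq, Equiv.apply_symm_apply]

/-- The action and observation maps have types that depend on the agent map, so they can only be
compared heterogeneously until the agent maps are identified. -/
theorem ext_of_heq {f g : Iso D E} (hN : ∀ i, f.agent i = g.agent i)
    (hS : ∀ s, f.state s = g.state s) (hA : ∀ i a, f.action i a ≍ g.action i a)
    (hO : ∀ i o, f.ob i o ≍ g.ob i o) : f = g := by
  obtain ⟨fN, fS, fA, fO, _, _, _, _⟩ := f
  obtain ⟨gN, gS, gA, gO, _, _, _, _⟩ := g
  obtain rfl : fN = gN := Equiv.ext hN
  obtain rfl : fS = gS := Equiv.ext hS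
  obtain rfl : fA = gA := funext fun i => Equiv.ext fun a => eq_of_heq (hA i a)
  obtain rfl : fO = gO := funext fun i => Equiv.ext fun o => eq_of_heq (hO i o)
  rfl

theorem trans_symm_self (f : Iso D E) : f.trans f.symm = Iso.refl D := by
  have key : ∀ {A : Fin N → Type u} {B : Fin N → Type v} (p : ∀ i, A i ≃ B (f.agent i))
      (i j : Fin N) (hij : j = i) (h : B (f.agent i) = B (f.agent j)) (a : A i),
      (p j).symm (cast h (p i a)) ≍ a := by
    rintro A B p i _ rfl h a
    simp
  refine ext_of_heq (fun i => f.agent.symm_apply_apply i) (fun s => f.state.symm_apply_apply s)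
    (fun i a => ?_) (fun i o => ?_)
  · exact key f.action i _ (f.agent.symm_apply_apply i) _ a
  · exact key f.ob i _ (f.agent.symm_apply_apply i) _ o

theorem symm_trans_self (f : Iso D E) : f.symm.trans f = Iso.refl E := by
  have key : ∀ {A : Fin N → Type u} {B : Fin N → Type v} (p : ∀ i, A i ≃ B (f.agent i))
      (i : Fin N) (j : Fin N) (h : B j = B (f.agent i)) (b : B j),
      p i ((p i).symm (cast h b)) ≍ b := by
    intro A B p i j h b
    rw [Equiv.apply_symm_apply]
    exact cast_heq h b
  refine ext_of_heq (fun i => f.agent.apply_symm_apply i) (fun s => f.state.apply_symm_apply s)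
    (fun i a => ?_) (fun i o => ?_)
  · exact key f.action _ _ _ a
  · exact key f.ob _ _ _ o

/-- Precomposition with an isomorphism. -/
def precomp (f : Iso D E) (F : DecPOMDP.{w} N T) : Iso E F ≃ Iso D F where
  toFun g := f.trans g
  invFun h := f.symm.trans h
  left_inv g := by
    change (f.symm.trans f).trans g = g
    rw [symm_trans_self]
    rfl
  right_inv h := by
    change (f.trans f.symm).trans h = h
    rw [trans_symm_self]
    rfl

/-- Postcomposition with an isomorphism. -/
def postcomp (D : DecPOMDP.{u} N T) (g : Iso E F) : Iso D E ≃ Iso D F where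
  toFun f := f.trans g
  invFun h := h.trans g.symm
  left_inv f := by
    change f.trans (g.trans g.symm) = f
    rw [trans_symm_self]
    rfl
  right_inv h := by
    change h.trans (g.symm.trans g) = h
    rw [symm_trans_self]
    rfl

theorem push_trans (f : Iso D E) (g : Iso E F) (π : D.Policy) :
    (f.trans g).push π = g.push (f.push π) := by
  funext k
  obtain ⟨i, rfl⟩ := (f.trans g).agent.surjective k
  rw [push_apply]
  change _ = g.push (f.push π) (g.agent (f.agent i))
  rw [push_apply, push_apply]
  rfl

theorem push_refl (π : D.Policy) : (Iso.refl D).push π = π := by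
  funext k
  exact (Iso.refl D).push_apply π k

theorem push_push_symm (f : Iso D E) (π : E.Policy) : f.push (f.symm.push π) = π := by
  rw [← push_trans, symm_trans_self, push_refl]

/-- The action of an isomorphism on episodes. -/
def episode (f : Iso D E) : D.Episode ≃ E.Episode where
  toFun ω := ⟨fun t => f.state (ω.state t), fun t => Equiv.piCongr f.agent f.action (ω.action t),
    fun t => Equiv.piCongr f.agent f.ob (ω.obsSeq t)⟩
  invFun ω := ⟨fun t => f.state.symm (ω.state t),
    fun t => (Equiv.piCongr f.agent f.action).symm (ω.action t),
    fun t => (Equiv.piCongr f.agent f.ob).symm (ω.obsSeq t)⟩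
  left_inv ω := by simp only [Equiv.symm_apply_apply]
  right_inv ω := by simp only [Equiv.apply_symm_apply]

theorem episode_action (f : Iso D E) (ω : D.Episode) (t : Fin (T + 1)) (i : Fin N) :
    (f.episode ω).action t (f.agent i) = f.action i (ω.action t i) :=
  Equiv.piCongr_apply_apply f.agent f.action (ω.action t) i

theorem episode_obsSeq (f : Iso D E) (ω : D.Episode) (t : Fin T) (i : Fin N) :
    (f.episode ω).obsSeq t (f.agent i) = f.ob i (ω.obsSeq t i) :=
  Equiv.piCongr_apply_apply f.agent f.ob (ω.obsSeq t) i

theorem episode_ao (f : Iso D E) (ω : D.Episode) (t : Fin (T + 1)) (i : Fin N) :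
    (f.episode ω).ao (f.agent i) t = f.aoMap i (ω.ao i t) := by
  unfold Episode.ao aoMap
  simp only [episode_action, episode_obsSeq]
  rfl

theorem envWeight_episode (f : Iso D E) (ω : D.Episode) :
    E.envWeight (f.episode ω) = D.envWeight ω := by
  unfold envWeight
  simp only [f.init_eq, f.trans_eq, f.obs_eq]
  rfl

theorem ret_episode (f : Iso D E) (ω : D.Episode) : (f.episode ω).ret = ω.ret := by
  unfold Episode.ret
  simp only [f.reward_eq]
  rfl

theorem seqWeight_localPush (f : Iso D E) (i : Fin N) (x : D.LocalPolicy i) (ω : D.Episode) :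
    E.seqWeight (f.agent i) (f.localPush i x) (f.episode ω) = D.seqWeight i x ω := by
  refine Finset.prod_congr rfl fun t _ => ?_
  rw [episode_ao, episode_action]
  unfold localPush
  rw [simplexCongr_apply_apply, Equiv.symm_apply_apply]

theorem seqWeight_push (f : Iso D E) (π : D.Policy) (i : Fin N) (ω : D.Episode) :
    E.seqWeight (f.agent i) (f.push π (f.agent i)) (f.episode ω) = D.seqWeight i (π i) ω := by
  rw [push_apply, seqWeight_localPush]

end Iso

/-- A labeling is an isomorphism onto the relabeled Dec-POMDP. -/
def Labeling.toIso {D : DecPOMDP.{u} N T} (f : Labeling D) : Iso D f.relabel where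
  agent := f.agent
  state := f.state
  action i := (f.action i).trans (finCongr (by rw [Equiv.symm_apply_apply]))
  ob i := (f.ob i).trans (finCongr (by rw [Equiv.symm_apply_apply]))
  trans_eq s s' a := by
    change _ = simplexCongr f.state (D.trans (f.state.symm (f.state s))
      (f.jointAction.symm (f.jointAction a))) (f.state s')
    simp only [simplexCongr_apply_apply, Equiv.symm_apply_apply]
  obs_eq s a o := by
    change _ = simplexCongr f.jointObs (D.obs (f.state.symm (f.state s))
      (f.jointAction.symm (f.jointAction a))) (f.jointObs o)
    simp only [simplexCongr_apply_apply, Equiv.symm_apply_apply]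
  reward_eq s a := by
    change _ = D.reward (f.state.symm (f.state s)) (f.jointAction.symm (f.jointAction a))
    simp only [Equiv.symm_apply_apply]
  init_eq s := (simplexCongr_apply_apply f.state D.init s).symm

theorem nonempty_iso_of_mem_relabeled (D : DecPOMDP.{u} N T) (E : D.relabeled) :
    Nonempty (Iso E.1 D) := by
  obtain ⟨_, f, rfl⟩ := E
  exact ⟨f.toIso.symm⟩

instance (D : DecPOMDP.{u} N T) : Nonempty D.relabeled :=
  ⟨⟨_, ⟨Equiv.refl _, Fintype.equivFin _, fun _ => Fintype.equivFin _,
    fun _ => Fintype.equivFin _⟩, rfl⟩⟩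

/-! ### Multilinear extension of the objective -/

/-- The expected return as a multilinear function of the agents' contributions. -/
def multiJ (D : DecPOMDP.{u} N T) (r : Fin N → D.Episode → ℝ) : ℝ :=
  ∑ ω, D.envWeight ω * ω.ret * ∏ i, r i ω

theorem J_eq_multiJ (D : DecPOMDP.{u} N T) (π : D.Policy) :
    D.J π = D.multiJ fun i => D.seqWeight i (π i) := by
  unfold J multiJ
  rw [integral_episodeMeasure]
  refine Finset.sum_congr rfl fun ω _ => ?_
  rw [episodeProb_eq]
  ring

/-- Agreement on episodes possible in the environment suffices, and it is all that the symmetrizer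
provides. -/
theorem multiJ_congr (D : DecPOMDP.{u} N T) {r r' : Fin N → D.Episode → ℝ}
    (h : ∀ i ω, D.envWeight ω ≠ 0 → r i ω = r' i ω) : D.multiJ r = D.multiJ r' := by
  refine Finset.sum_congr rfl fun ω _ => ?_
  by_cases hω : D.envWeight ω = 0
  · simp [hω]
  · simp only [h _ ω hω]

theorem multiJ_iso {D : DecPOMDP.{u} N T} {E : DecPOMDP.{v} N T} (f : Iso D E)
    {r : Fin N → D.Episode → ℝ} {r' : Fin N → E.Episode → ℝ}
    (h : ∀ i ω, r' (f.agent i) (f.episode ω) = r i ω) : E.multiJ r' = D.multiJ r := by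
  unfold multiJ
  rw [← Equiv.sum_comp f.episode]
  refine Finset.sum_congr rfl fun ω _ => ?_
  rw [f.envWeight_episode, f.ret_episode, ← Equiv.prod_comp f.agent]
  simp only [h]

theorem expect_prod_pi {ι : Type*} [Fintype ι] [DecidableEq ι] {κ : ι → Type*} [∀ i, Fintype (κ i)]
    (F : ∀ i, κ i → ℝ) : 𝔼 p : (∀ i, κ i), ∏ i, F i (p i) = ∏ i, 𝔼 k, F i k := by
  simp only [Fintype.expect_eq_sum_div_card, Finset.prod_div_distrib, Fintype.card_pi,
    Nat.cast_prod, Fintype.prod_sum]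

/-- The average contribution of agent `l` in `E` over all transports of `π` to `E`. -/
def orbitAvg {D : DecPOMDP.{u} N T} (E : DecPOMDP.{v} N T) (π : D.Policy) (l : Fin N)
    (ω : E.Episode) : ℝ :=
  𝔼 f : Iso D E, E.seqWeight l (f.push π l) ω

/-- Precomposition with `h` is a bijection between the isomorphisms into `F`, so the orbit average
depends only on the orbit of the policy. -/
theorem orbitAvg_push {D : DecPOMDP.{u} N T} {E : DecPOMDP.{v} N T} (F : DecPOMDP.{w} N T)
    (h : Iso D E) (π : D.Policy) : orbitAvg F (h.push π) = orbitAvg F π := by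
  funext l ω
  refine Fintype.expect_equiv (h.precomp F) _ _ fun g => ?_
  change _ = F.seqWeight l ((h.trans g).push π l) ω
  rw [Iso.push_trans]

theorem orbitAvg_episode {D : DecPOMDP.{u} N T} {E : DecPOMDP.{v} N T} {F : DecPOMDP.{w} N T}
    (g : Iso E F) (π : D.Policy) (l : Fin N) (ω : E.Episode) :
    orbitAvg F π (g.agent l) (g.episode ω) = orbitAvg E π l ω := by
  refine (Fintype.expect_equiv (Iso.postcomp D g) _ _ fun f => ?_).symm
  change _ = F.seqWeight (g.agent l) ((f.trans g).push π (g.agent l)) (g.episode ω)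
  rw [Iso.push_trans, Iso.seqWeight_push]

/-- The automorphisms of different agents are drawn independently, so the average of the product of
contributions is the product of their averages. -/
theorem JOP_eq_multiJ (D : DecPOMDP.{u} N T) (π : D.Policy) :
    D.JOP π = D.multiJ (orbitAvg D π) := by
  unfold JOP
  simp only [J_eq_multiJ, multiJ]
  rw [Finset.expect_sum_comm]
  refine Finset.sum_congr rfl fun ω _ => ?_
  rw [← Finset.mul_expect]
  refine congrArg₂ _ rfl ?_
  exact expect_prod_pi fun l (g : D.Aut) => D.seqWeight l (g.push π l) ω

theorem JOP_push {D : DecPOMDP.{u} N T} {E : DecPOMDP.{v} N T} (f : Iso D E) (π : D.Policy) :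
    E.JOP (f.push π) = D.JOP π := by
  rw [JOP_eq_multiJ, JOP_eq_multiJ, orbitAvg_push]
  exact multiJ_iso f fun i ω => orbitAvg_episode f π i ω

theorem push_mem_opOptimal {D : DecPOMDP.{u} N T} {E : DecPOMDP.{v} N T} (f : Iso D E)
    {π : D.Policy} (hπ : π ∈ D.opOptimal) : f.push π ∈ E.opOptimal := by
  intro π'
  rw [JOP_push, ← f.push_push_symm π', JOP_push]
  exact hπ _

/-! ### Orbit averages and the symmetrizer -/

theorem integral_opDist_marginal (D : DecPOMDP.{u} N T) (π : D.Policy) (i : Fin N)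
    (ω : D.Episode) :
    ∫ x, D.seqWeight i x ω ∂((D.opDist π).map (measurable_pi_apply i).aemeasurable :
      Measure (D.LocalPolicy i)) = orbitAvg D π i ω := by
  classical
  rw [ProbabilityMeasure.toMeasure_map, integral_map (measurable_pi_apply i).aemeasurable
    (D.measurable_seqWeight i ω).aestronglyMeasurable]
  have hm : StronglyMeasurable fun ρ : D.Policy => D.seqWeight i (ρ i) ω :=
    ((D.measurable_seqWeight i ω).comp (measurable_pi_apply i)).stronglyMeasurable
  change ∫ ρ, D.seqWeight i (ρ i) ω ∂((Fintype.card (Fin N → D.Aut) : ℝ≥0∞)⁻¹ •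
      ∑ g : Fin N → D.Aut, Measure.dirac (D.profilePush g π)) = _
  rw [integral_smul_measure, integral_finsetSum_measure fun g _ =>
    integrable_of_mem_Icc hm.measurable (fun ρ => D.seqWeight_nonneg _ _ _)
      (fun ρ => D.seqWeight_le_one _ _ _)]
  simp only [integral_dirac' _ _ hm]
  -- Only the `i`-th automorphism matters; filling the other factors with `1` turns the average over
  -- profiles into a product with one nontrivial factor.
  have := expect_prod_pi (ι := Fin N) (κ := fun _ => D.Aut)
    (fun l g => if l = i then D.seqWeight i (g.push π i) ω else 1)
  simp only [Finset.prod_ite_eq', Finset.mem_univ, if_true] at this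
  have h2 : ∏ l, 𝔼 g : D.Aut, (if l = i then D.seqWeight i (g.push π i) ω else 1) =
      orbitAvg D π i ω := by
    rw [Finset.prod_eq_single i]
    · simp [orbitAvg]
    · intro l _ hl
      simp only [hl, if_false]
      exact Fintype.expect_const 1
    · simp
  rw [← h2, ← this, Fintype.expect_eq_sum_div_card, smul_eq_mul, ENNReal.toReal_inv,
    ENNReal.toReal_natCast, div_eq_inv_mul]
  rfl

theorem orbitAvg_eq_of_equivalent (D : DecPOMDP.{u} N T) {π π' : D.Policy}
    (h : D.Equivalent π π') (i : Fin N) (ω : D.Episode) (hω : D.envWeight ω ≠ 0) :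
    orbitAvg D π i ω = orbitAvg D π' i ω := by
  rw [← integral_opDist_marginal, ← integral_opDist_marginal,
    ← D.seqWeight_correspondingLocal i _ ω hω, ← D.seqWeight_correspondingLocal i _ ω hω]
  exact congrArg (fun ρ : D.Policy => D.seqWeight i (ρ i) ω) h

/-! ### First-order optimality and unilateral deviations -/

theorem multiJ_update (D : DecPOMDP.{u} N T) (r : Fin N → D.Episode → ℝ) (k : Fin N)
    (q : D.Episode → ℝ) : D.multiJ (Function.update r k q) =
      ∑ ω, D.envWeight ω * ω.ret * (∏ j ∈ Finset.univ.erase k, r j ω) * q ω := by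
  refine Finset.sum_congr rfl fun ω _ => ?_
  rw [← Finset.mul_prod_erase _ _ (Finset.mem_univ k), Function.update_self,
    Finset.prod_congr rfl fun j hj => by rw [Function.update_of_ne (Finset.ne_of_mem_erase hj)]]
  ring

theorem multiJ_update_expect (D : DecPOMDP.{u} N T) (r : Fin N → D.Episode → ℝ) (k : Fin N)
    {ι : Type*} [Fintype ι] (q : ι → D.Episode → ℝ) :
    D.multiJ (Function.update r k fun ω => 𝔼 j, q j ω) =
      𝔼 j, D.multiJ (Function.update r k (q j)) := by
  simp only [multiJ_update]
  rw [Finset.expect_sum_comm]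
  simp only [Finset.mul_expect]

/-- Along the segment from `r` to `s` the value is a polynomial in `ε` that never exceeds its value
at `0`. Its derivative there is, by multilinearity, the difference of the two sums. -/
theorem sum_multiJ_update_le (D : DecPOMDP.{u} N T) (r s : Fin N → D.Episode → ℝ)
    (h : ∀ ε ∈ Set.Ioc (0 : ℝ) 1,
      D.multiJ (fun l ω => (1 - ε) * r l ω + ε * s l ω) ≤ D.multiJ r) :
    ∑ l, D.multiJ (Function.update r l (s l)) ≤ ∑ l, D.multiJ (Function.update r l (r l)) := by
  set φ : ℝ → ℝ := fun ε => D.multiJ (fun l ω => (1 - ε) * r l ω + ε * s l ω) with hφ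
  have h0 : φ 0 = D.multiJ r := by simp [hφ]
  have hder : HasDerivAt φ (∑ l, D.multiJ (Function.update r l (s l)) -
      ∑ l, D.multiJ (Function.update r l (r l))) 0 := by
    have hterm : ∀ ω : D.Episode, HasDerivAt
        (fun ε : ℝ => D.envWeight ω * ω.ret * ∏ l, ((1 - ε) * r l ω + ε * s l ω))
        (D.envWeight ω * ω.ret * ∑ l, (∏ j ∈ Finset.univ.erase l, r j ω) * (s l ω - r l ω)) 0 := by
      intro ω
      refine HasDerivAt.const_mul _ ?_
      have hlin : ∀ l ∈ Finset.univ, HasDerivAt (fun ε : ℝ => (1 - ε) * r l ω + ε * s l ω)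
          (s l ω - r l ω) 0 := by
        intro l _
        have := (((hasDerivAt_id (0 : ℝ)).const_sub 1).mul_const (r l ω)).add
          ((hasDerivAt_id (0 : ℝ)).mul_const (s l ω))
        exact this.congr_deriv (by ring)
      have := HasDerivAt.fun_finsetProd hlin
      simpa using this
    have := HasDerivAt.fun_sum fun ω (_ : ω ∈ Finset.univ) => hterm ω
    refine this.congr_deriv ?_
    simp only [multiJ_update]
    simp only [← Finset.sum_sub_distrib, Finset.mul_sum]
    rw [Finset.sum_comm]
    refine Finset.sum_congr rfl fun l _ => Finset.sum_congr rfl fun ω _ => ?_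
    ring
  have hslope := hasDerivAt_iff_tendsto_slope.1 hder
  -- Only `ε > 0` is controlled, so the derivative is taken as a limit from the right.
  have hlim := hslope.mono_left (nhdsWithin_mono (0 : ℝ)
    (show Set.Ioi (0 : ℝ) ⊆ {0}ᶜ from fun x hx => ne_of_gt hx))
  refine sub_nonpos.1 (le_of_tendsto hlim ?_)
  filter_upwards [Ioc_mem_nhdsGT (zero_lt_one (α := ℝ))] with ε hε
  rw [slope_def_field, h0, sub_zero]
  exact div_nonpos_of_nonpos_of_nonneg (sub_nonpos.2 (h ε hε)) hε.1.le

/-- Kuhn's theorem for a two-point mixture. Averaging the action probabilities at each history would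
not do, as `seqWeight` is a product over time. -/
theorem exists_seqWeight_convexCombination (D : DecPOMDP.{u} N T) (i : Fin N)
    (x y : D.LocalPolicy i) {ε : ℝ} (h0 : 0 ≤ ε) (h1 : ε ≤ 1) :
    ∃ z : D.LocalPolicy i, ∀ ω,
      D.seqWeight i z ω = (1 - ε) * D.seqWeight i x ω + ε * D.seqWeight i y ω := by
  let μ : Measure (D.LocalPolicy i) :=
    ENNReal.ofReal (1 - ε) • Measure.dirac x + ENNReal.ofReal ε • Measure.dirac y
  have : IsProbabilityMeasure μ := ⟨by
    simp only [μ, Measure.add_apply, Measure.smul_apply, measure_univ, smul_eq_mul, mul_one]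
    rw [← ENNReal.ofReal_add (by linarith) h0, sub_add_cancel, ENNReal.ofReal_one]⟩
  obtain ⟨z, hz⟩ := D.exists_seqWeight_eq_integral i μ
  refine ⟨z, fun ω => ?_⟩
  have hm := (D.measurable_seqWeight i ω).stronglyMeasurable
  rw [hz, integral_add_measure
    ((D.integrable_seqWeight i ω _).smul_measure ENNReal.ofReal_ne_top)
    ((D.integrable_seqWeight i ω _).smul_measure ENNReal.ofReal_ne_top),
    integral_smul_measure, integral_smul_measure, integral_dirac' _ _ hm, integral_dirac' _ _ hm,
    ENNReal.toReal_ofReal h0, ENNReal.toReal_ofReal (by linarith)]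
  rfl

theorem orbitAvg_update (D : DecPOMDP.{u} N T) (π : D.Policy) (k : Fin N)
    (x z : D.LocalPolicy k) (ε : ℝ)
    (hz : ∀ ω, D.seqWeight k z ω = (1 - ε) * D.seqWeight k (π k) ω + ε * D.seqWeight k x ω) :
    orbitAvg D (Function.update π k z) = fun l ω =>
      (1 - ε) * orbitAvg D π l ω + ε * orbitAvg D (Function.update π k x) l ω := by
  funext l ω
  unfold orbitAvg
  rw [Finset.mul_expect, Finset.mul_expect, ← Finset.expect_add_distrib]
  refine Finset.expect_congr rfl fun f _ => ?_
  obtain ⟨j, rfl⟩ := f.agent.surjective l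
  obtain ⟨ω, rfl⟩ := f.episode.surjective ω
  simp only [Iso.seqWeight_push]
  by_cases hj : j = k
  · subst hj
    simp only [Function.update_self, hz]
  · simp only [Function.update_of_ne hj]
    ring

/-- The return if agent `l` follows `y` against the symmetrized policy of the other agents is
invariant under automorphisms. -/
theorem multiJ_update_localPush (D : DecPOMDP.{u} N T) (π : D.Policy) (f : D.Aut) (j : Fin N)
    (y : D.LocalPolicy j) :
    D.multiJ (Function.update (orbitAvg D π) (f.agent j)
        (D.seqWeight (f.agent j) (f.localPush j y))) =
      D.multiJ (Function.update (orbitAvg D π) j (D.seqWeight j y)) := by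
  refine multiJ_iso f fun i ω => ?_
  by_cases hi : i = j
  · subst hi
    simp only [Function.update_self, Iso.seqWeight_localPush]
  · rw [Function.update_of_ne hi, Function.update_of_ne (fun h => hi (f.agent.injective h)),
      orbitAvg_episode]

/-- Expand the replaced average over automorphisms `f` and reindex agents by `f.agent`: by symmetry
every `f` contributes the same sum, in which each agent deviates to its own unsymmetrized policy. -/
theorem sum_multiJ_update_orbitAvg (D : DecPOMDP.{u} N T) (π ρ : D.Policy) :
    ∑ l, D.multiJ (Function.update (orbitAvg D π) l (orbitAvg D ρ l)) =
      ∑ j, D.multiJ (Function.update (orbitAvg D π) j (D.seqWeight j (ρ j))) := by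
  have h1 : ∀ l, D.multiJ (Function.update (orbitAvg D π) l (orbitAvg D ρ l)) =
      𝔼 f : D.Aut, D.multiJ (Function.update (orbitAvg D π) l (D.seqWeight l (f.push ρ l))) :=
    fun l => D.multiJ_update_expect (orbitAvg D π) l fun f : D.Aut => D.seqWeight l (f.push ρ l)
  simp only [h1]
  rw [← Finset.expect_sum_comm]
  have h2 : ∀ f : D.Aut,
      ∑ l, D.multiJ (Function.update (orbitAvg D π) l (D.seqWeight l (f.push ρ l))) =
      ∑ j, D.multiJ (Function.update (orbitAvg D π) j (D.seqWeight j (ρ j))) := by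
    intro f
    rw [← Equiv.sum_comp f.agent]
    simp only [Iso.push_apply, multiJ_update_localPush]
  simp only [h2]
  exact Fintype.expect_const _

/-- The symmetrization of an OP-optimal policy is a Nash equilibrium of `D`. -/
theorem multiJ_update_le_of_opOptimal (D : DecPOMDP.{u} N T) {π : D.Policy}
    (hπ : π ∈ D.opOptimal) (k : Fin N) (x : D.LocalPolicy k) :
    D.multiJ (Function.update (orbitAvg D π) k (D.seqWeight k x)) ≤ D.multiJ (orbitAvg D π) := by
  have hdev : ∀ (k : Fin N) (x : D.LocalPolicy k),
      D.multiJ (Function.update (orbitAvg D π) k (D.seqWeight k x)) ≤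
        D.multiJ (Function.update (orbitAvg D π) k (D.seqWeight k (π k))) := by
    intro k x
    have h := D.sum_multiJ_update_le (orbitAvg D π) (orbitAvg D (Function.update π k x)) ?_
    -- The two policies differ only at agent `k`, so all other terms cancel.
    · rw [sum_multiJ_update_orbitAvg, sum_multiJ_update_orbitAvg,
        ← Finset.add_sum_erase _ _ (Finset.mem_univ k),
        ← Finset.add_sum_erase (a := k) _ (fun j => D.multiJ (Function.update (orbitAvg D π) j
          (D.seqWeight j (π j)))) (Finset.mem_univ k), Function.update_self,
        Finset.sum_congr rfl fun j hj => by
          rw [Function.update_of_ne (Finset.ne_of_mem_erase hj)]] at h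
      exact le_of_add_le_add_right h
    · intro ε hε
      obtain ⟨z, hz⟩ := D.exists_seqWeight_convexCombination k (π k) x hε.1.le hε.2
      rw [← D.orbitAvg_update π k x z ε hz, ← JOP_eq_multiJ, ← JOP_eq_multiJ]
      exact hπ _
  set W : Fin N → ℝ := fun j =>
    D.multiJ (Function.update (orbitAvg D π) j (D.seqWeight j (π j))) with hW
  -- The transported policy `f.localPush j (π j)` is one of the deviations open to `f.agent j`. Used
  -- for `f.symm`, this makes `W` constant on orbits of agents.
  have hmono : ∀ (f : D.Aut) (j : Fin N), W j ≤ W (f.agent j) := by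
    intro f j
    have := hdev (f.agent j) (f.localPush j (π j))
    rwa [multiJ_update_localPush] at this
  refine (hdev k x).trans ?_
  -- Expanding coordinate `k` alone writes the value as the average of `W` over the preimages of `k`
  -- under automorphisms.
  have hr : D.multiJ (orbitAvg D π) = 𝔼 f : D.Aut,
      D.multiJ (Function.update (orbitAvg D π) k (D.seqWeight k (f.push π k))) := by
    conv_lhs => rw [← Function.update_eq_self k (orbitAvg D π)]
    exact D.multiJ_update_expect (orbitAvg D π) k fun f : D.Aut => D.seqWeight k (f.push π k)
  rw [hr]
  refine Finset.le_expect Finset.univ_nonempty fun f _ => ?_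
  obtain ⟨j, rfl⟩ := f.agent.surjective k
  rw [Iso.push_apply, multiJ_update_localPush]
  have := hmono f.symm (f.agent j)
  rwa [show f.symm.agent (f.agent j) = j from f.agent.symm_apply_apply j] at this

/-! ### The payoff of the label-free coordination game -/

theorem measurable_seqWeight_push {D : DecPOMDP.{u} N T} {E : DecPOMDP.{v} N T} (f : Iso D E)
    (l : Fin N) (ω : E.Episode) : Measurable fun π : D.Policy => E.seqWeight l (f.push π l) ω :=
  ((E.measurable_seqWeight l ω).comp (measurable_pi_apply l)).comp f.measurable_push

theorem integrable_seqWeight_push {D : DecPOMDP.{u} N T} {E : DecPOMDP.{v} N T} (f : Iso D E)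
    (l : Fin N) (ω : E.Episode) (μ : Measure D.Policy) [IsFiniteMeasure μ] :
    Integrable (fun π : D.Policy => E.seqWeight l (f.push π l) ω) μ :=
  integrable_of_mem_Icc (measurable_seqWeight_push f l ω) (fun _ => E.seqWeight_nonneg _ _ _)
    (fun _ => E.seqWeight_le_one _ _ _)

theorem integrable_orbitAvg {D : DecPOMDP.{u} N T} (E : DecPOMDP.{v} N T) (l : Fin N)
    (ω : E.Episode) (μ : Measure D.Policy) [IsFiniteMeasure μ] :
    Integrable (fun π : D.Policy => orbitAvg E π l ω) μ := by
  simp only [orbitAvg, Fintype.expect_eq_sum_div_card]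
  exact (integrable_finsetSum _ fun f _ => integrable_seqWeight_push f l ω μ).div_const _

theorem integral_orbitAvg {D : DecPOMDP.{u} N T} (E : DecPOMDP.{v} N T) (l : Fin N)
    (ω : E.Episode) (μ : Measure D.Policy) [IsFiniteMeasure μ] :
    ∫ π, orbitAvg E π l ω ∂μ = 𝔼 f : Iso D E, ∫ π, E.seqWeight l (f.push π l) ω ∂μ := by
  simp only [orbitAvg, Fintype.expect_eq_sum_div_card]
  rw [integral_div, integral_finsetSum _ fun f _ => integrable_seqWeight_push f l ω μ]

/-- The average contribution of agent `l` if its principal uses the learning algorithm `σ`. -/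
def algorithmWeight (D : DecPOMDP.{u} N T) (σ : LearningAlgorithm D.relabeled) (l : Fin N)
    (ω : D.Episode) : ℝ :=
  𝔼 E : D.relabeled, ∫ π, orbitAvg D π l ω ∂(σ E : Measure E.1.Policy)

theorem integral_J_pi (D : DecPOMDP.{u} N T) (ν : Fin N → ProbabilityMeasure D.Policy) :
    ∫ π : Fin N → D.Policy, D.J (fun l => π l l) ∂(Measure.pi fun k => (ν k : Measure D.Policy)) =
      D.multiJ fun l ω => ∫ π, D.seqWeight l (π l) ω ∂(ν l : Measure D.Policy) := by
  simp only [J_eq_multiJ, multiJ]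
  rw [integral_finsetSum]
  · refine Finset.sum_congr rfl fun ω _ => ?_
    rw [integral_const_mul,
      integral_fintype_prod_eq_prod (fun l (π : D.Policy) => D.seqWeight l (π l) ω)]
  · intro ω _
    refine Integrable.const_mul (integrable_of_mem_Icc ?_ ?_ ?_) _
    · exact Finset.measurable_prod _ fun l _ => ((D.measurable_seqWeight l ω).comp
        (measurable_pi_apply l)).comp (measurable_pi_apply l)
    · exact fun _ => Finset.prod_nonneg fun l _ => D.seqWeight_nonneg _ _ _
    · exact fun _ => Finset.prod_le_one (fun l _ => D.seqWeight_nonneg _ _ _)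
        fun l _ => D.seqWeight_le_one _ _ _

/-- The contribution of agent `l` depends only on the draws of principal `l`, and these are
independent of the others at each of the three levels: problem, isomorphism and policy. -/
theorem payoff_eq_multiJ (D : DecPOMDP.{u} N T) (σ : Fin N → LearningAlgorithm D.relabeled) :
    D.payoff σ = D.multiJ fun l => D.algorithmWeight (σ l) l := by
  classical
  unfold payoff
  simp only [integral_J_pi, multiJ]
  simp only [Finset.expect_sum_comm, ← Finset.mul_expect]
  refine Finset.sum_congr rfl fun ω _ => congrArg₂ _ rfl ?_
  have hint : ∀ (l : Fin N) (E : D.relabeled) (f : Iso E.1 D),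
      ∫ π, D.seqWeight l (π l) ω ∂(f.pushDist (σ l E) : Measure D.Policy) =
      ∫ π, D.seqWeight l (f.push π l) ω ∂(σ l E : Measure E.1.Policy) := by
    intro l E f
    unfold Iso.pushDist
    rw [ProbabilityMeasure.toMeasure_map]
    exact integral_map f.measurable_push.aemeasurable
      ((D.measurable_seqWeight l ω).comp (measurable_pi_apply l)).aestronglyMeasurable
  simp only [hint]
  -- The types of isomorphisms vary with `Ds`, so the inner average is factored for each fixed `Ds`
  -- first.
  rw [Finset.expect_congr rfl fun (Ds : Fin N → D.relabeled) _ =>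
    expect_prod_pi (κ := fun l => Iso (Ds l).1 D) fun l f =>
      ∫ π, D.seqWeight l (f.push π l) ω ∂(σ l (Ds l) : Measure (Ds l).1.Policy)]
  simp only [← integral_orbitAvg]
  exact expect_prod_pi fun l (E : D.relabeled) =>
    ∫ π, orbitAvg D π l ω ∂(σ l E : Measure E.1.Policy)

/-- Each transport of `π` to `D` is an ordinary deviation. An isomorphism must exist, because an
average over an empty type is `0` rather than a mean of deviations. -/
theorem multiJ_update_orbitAvg_le (D : DecPOMDP.{u} N T) {E : DecPOMDP.{v} N T} {ρ : D.Policy}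
    (hρ : ρ ∈ D.opOptimal) [Nonempty (Iso E D)] (i : Fin N) (π : E.Policy) :
    D.multiJ (Function.update (orbitAvg D ρ) i (orbitAvg D π i)) ≤ D.multiJ (orbitAvg D ρ) := by
  have := D.multiJ_update_expect (orbitAvg D ρ) i fun f : Iso E D => D.seqWeight i (f.push π i)
  refine this.trans_le (Finset.expect_le Finset.univ_nonempty fun f _ => ?_)
  exact D.multiJ_update_le_of_opOptimal hρ i _

theorem multiJ_update_algorithmWeight_le (D : DecPOMDP.{u} N T) {ρ : D.Policy}
    (hρ : ρ ∈ D.opOptimal) (i : Fin N) (σ : LearningAlgorithm D.relabeled) :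
    D.multiJ (Function.update (orbitAvg D ρ) i (D.algorithmWeight σ i)) ≤
      D.multiJ (orbitAvg D ρ) := by
  have := D.multiJ_update_expect (orbitAvg D ρ) i fun (E : D.relabeled) ω =>
    ∫ π, orbitAvg D π i ω ∂(σ E : Measure E.1.Policy)
  refine this.trans_le (Finset.expect_le Finset.univ_nonempty fun E _ => ?_)
  have := D.nonempty_iso_of_mem_relabeled E
  rw [multiJ_update]
  simp only [← integral_const_mul]
  have hint : ∀ ω ∈ Finset.univ, Integrable (fun π : E.1.Policy => D.envWeight ω * ω.ret *
      (∏ j ∈ Finset.univ.erase i, orbitAvg D ρ j ω) * orbitAvg D π i ω)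
      (σ E : Measure E.1.Policy) := fun ω _ => (integrable_orbitAvg D i ω _).const_mul _
  rw [← integral_finsetSum _ hint]
  refine (integral_mono (integrable_finsetSum _ hint) (integrable_const (D.multiJ (orbitAvg D ρ)))
    fun π => ?_).trans_eq (by simp)
  have := D.multiJ_update_orbitAvg_le hρ i π
  rwa [multiJ_update] at this

/-- Policies that are optimal for other-play and maximize the tie-breaking function have the same
orbit average. -/
theorem orbitAvg_eq_of_tieBreaking (D : DecPOMDP.{u} N T)
    {χ : ∀ E : D.relabeled, E.1.Policy → Set.Icc (0 : ℝ) 1}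
    (hχ : IsTieBreaking D.relabeled χ) (hinv : InvariantToIso D.relabeled χ)
    {E F : D.relabeled} {π : E.1.Policy} {ρ : F.1.Policy}
    (hπ : π ∈ E.1.opOptimal) (hπ' : ∀ π' ∈ E.1.opOptimal, χ E π' ≤ χ E π)
    (hρ : ρ ∈ F.1.opOptimal) (hρ' : ∀ ρ' ∈ F.1.opOptimal, χ F ρ' ≤ χ F ρ)
    (l : Fin N) (ω : D.Episode) (hω : D.envWeight ω ≠ 0) :
    orbitAvg D π l ω = orbitAvg D ρ l ω := by
  obtain ⟨f⟩ := D.nonempty_iso_of_mem_relabeled E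
  obtain ⟨g⟩ := D.nonempty_iso_of_mem_relabeled F
  let h : Iso E.1 F.1 := f.trans g.symm
  have hEF : ∀ π₁ : E.1.Policy, χ E π₁ = χ F (h.push π₁) := fun π₁ => hinv E F h π₁ _ rfl
  -- Transport along `h` and back preserves OP-optimality and `χ`, so the maxima of `χ` over the
  -- OP-optimal policies of `E` and `F` agree and `h.push π` attains the latter.
  have heq : χ F (h.push π) = χ F ρ := by
    refine le_antisymm (hρ' _ (push_mem_opOptimal h hπ)) ?_
    rw [← h.push_push_symm ρ, ← hEF, ← hEF]
    exact hπ' _ (push_mem_opOptimal h.symm hρ)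
  have hequiv := hχ.equivalent_of_eq F _ _ heq
  obtain ⟨l, rfl⟩ := g.agent.surjective l
  obtain ⟨ω, rfl⟩ := g.episode.surjective ω
  -- The equivalence obtained from `χ` holds in `F`, so the comparison of orbit averages is pulled
  -- back from `D` to `F` along `g`.
  rw [g.envWeight_episode] at hω
  rw [orbitAvg_episode, orbitAvg_episode, ← orbitAvg_push F.1 h π]
  exact F.1.orbitAvg_eq_of_equivalent hequiv l ω hω

end DecPOMDP

end

/-! ### The equilibrium -/

theorem mainTheorem3 {N T : ℕ} (D : DecPOMDP.{u} N T)
    (χ : ∀ E : D.relabeled, E.1.Policy → Set.Icc (0 : ℝ) 1)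
    (hχ : DecPOMDP.IsTieBreaking D.relabeled χ)
    (hinv : DecPOMDP.InvariantToIso D.relabeled χ)
    (σ : DecPOMDP.LearningAlgorithm D.relabeled)
    (hσ : DecPOMDP.IsOPWithTieBreaking D.relabeled χ σ) :
    D.IsNashEquilibrium (fun _ => σ) := by
  classical
  obtain ⟨F⟩ : Nonempty D.relabeled := inferInstance
  -- One maximizer on one relabeled problem serves as reference: everything `σ` samples has the same
  -- orbit averages in `D` as `ρ`, wherever the environment weight is nonzero.
  obtain ⟨ρ, hρ, hρ'⟩ := hχ.attains_max F
  obtain ⟨g⟩ := D.nonempty_iso_of_mem_relabeled F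
  have hopt := DecPOMDP.push_mem_opOptimal g hρ
  have hweight : ∀ l ω, D.envWeight ω ≠ 0 →
      D.algorithmWeight σ l ω = DecPOMDP.orbitAvg D (g.push ρ) l ω := by
    intro l ω hω
    rw [DecPOMDP.orbitAvg_push]
    unfold DecPOMDP.algorithmWeight
    refine (Finset.expect_congr rfl fun E _ => ?_).trans (Fintype.expect_const _)
    obtain ⟨Z, hZ, -, hZ1, hZχ⟩ := hσ E
    have hae : ∀ᵐ π ∂(σ E : Measure E.1.Policy),
        DecPOMDP.orbitAvg D π l ω = DecPOMDP.orbitAvg D ρ l ω := by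
      filter_upwards [(mem_ae_iff_prob_eq_one hZ).2 hZ1] with π hπ
      exact D.orbitAvg_eq_of_tieBreaking hχ hinv (hZχ hπ).1 (hZχ hπ).2 hρ hρ' l ω hω
    rw [integral_congr_ae hae]
    simp
  intro i σ'
  -- Both payoffs become values of `multiJ` at the orbit averages of the OP-optimal policy `g.push
  -- ρ`, the deviating one with coordinate `i` replaced.
  rw [DecPOMDP.payoff_eq_multiJ, DecPOMDP.payoff_eq_multiJ, D.multiJ_congr hweight,
    D.multiJ_congr (r' := Function.update (DecPOMDP.orbitAvg D (g.push ρ)) i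
      (D.algorithmWeight σ' i)) ?_]
  · exact D.multiJ_update_algorithmWeight_le hopt i σ'
  · intro l ω hω
    by_cases hl : l = i
    · subst hl
      simp only [Function.update_self]
    · simp only [Function.update_of_ne hl]
      exact hweight l ω hω
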